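/- Let $\mathcal S=(\mathcal S,\otimes,\mathbb 1)$ be a symmetric monoidal category. **The category $\mathcal F(\mathcal S)$.** Its objects are pairs $(\mathcal C,F)$ where $\mathcal C$ is a small category and $F\colon\mathcal C\to\mathcal S$ is a functor. A morphism $(\mathcal C,F)\to(\mathcal D,G)$ is a pair $(\Gamma,\gamma)$ of a functor $\Gamma\colon\mathcal C\to\mathcal D$ and a natural transformation $\gamma\colon F\to G\Gamma$; the composite of $(\Gamma,\gamma)$ followed by $(\Lambda,\lambda)$ is $(\Lambda\Gamma,\{\lambda_{\Gamma(X)}\gamma_X\}_X)$. It is symmetric monoidal with $(\mathcal C,F)\boxtimes(\mathcal D,G)=(\mathcal C\times\mathcal D,\otimes\circ(F\times G))$, $(\Gamma,\gamma)\boxtimes(\Lambda,\lambda)=(\Gamma\times\Lambda,\{\gamma_X\otimes\lambda_Y\}_{(X,Y)})$, unit object the trivial category with the functor of value $\mathbb 1$, and constraints and symmetry induced from those of $\mathrm{Cat}$ and $\mathcal S$. A *Hopf algebra* in a braided category is a bialgebra which admits an invertible antipode; morphisms of Hopf algebras are the morphisms of bialgebras. **Hopf $\xi$-algebras.** A crossed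 module is a group homomorphism $\xi\colon E\to H$ with an action $(x,e)\mapsto{}^xe$ of $H$ on $E$ by automorphisms such that $\xi({}^xe)=x\xi(e)x^{-1}$ and ${}^{\xi(e)}f=efe^{-1}$. A *Hopf $\xi$-algebra in $\mathcal S$* is a family $A=\{(A_x,\Delta_x,\varepsilon_x)\}_{x\in H}$ of coalgebras in $\mathcal S$ with coalgebra morphisms $\mu_{x,y}\colon A_x\otimes A_y\to A_{xy}$ and $\eta\colon\mathbb 1\to A_1$, isomorphisms $S_x\colon A_x\to A_{x^{-1}}$ in $\mathcal S$ and coalgebra isomorphisms $\phi_{x,e}\colon A_x\to A_{\xi(e)x}$ such that $\mu$ is associative and unital with unit $\eta$, and for all $x,y\in H$, $e,f\in E$, $$\mu_{x^{-1},x}(S_x\otimes\mathrm{id}_{A_x})\Delta_x=\eta\,\varepsilon_x=\mu_{x,x^{-1}}(\mathrm{id}_{A_x}\otimes S_x)\Delta_x,$$ $$\phi_{x,1}=\mathrm{id}_{A_x},\qquad \phi_{\xi(e)x,f}\,\phi_{x,e}=\phi_{x,fe},\qquad \mu_{\xi(e)x,\xi(f)y}(\phi_{x,e}\otimes\phi_{y,f})=\phi_{xy,\,e\,{}^xf}\,\mu_{x,y}.$$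 A morphism of pairs $(\xi,A)\to(\xi',A')$ is a morphism of crossed modules $(\psi\colon E\to E',\varphi\colon H\to H')$ together with coalgebra morphisms $A_x\to A'_{\varphi(x)}$, $x\in H$, compatible with the products, the units and the actions. **The correspondence.** To a pair $(\xi,A)$ of a crossed module $\xi\colon E\to H$ and a Hopf $\xi$-algebra $A$ in $\mathcal S$, assign the Hopf algebra $(\mathcal G_\xi,F_A)$ in $\mathcal F(\mathcal S)$, where $\mathcal G_\xi$ is the category with set of objects $H$, with $\mathrm{Hom}(x,y)=\{e\in E\mid y=\xi(e)x\}$ and with composition $f\circ e=fe$, and where $F_A(x)=A_x$ and $F_A(e\colon x\to\xi(e)x)=\phi_{x,e}$. Its product is $(m_\xi,\mu)$, its unit $(u_\xi,\eta)$, its coproduct $(\Delta_\xi,\Delta)$, its counit $(\varepsilon_\xi,\varepsilon)$ and its antipode $(S_\xi,S)$, where $m_\xi(x,y)=xy$ and $m_\xi(x\xrightarrow{e}y,\,z\xrightarrow{f}t)=(xz\xrightarrow{e\,{}^xf}yt)$; $u_\xi(*)=1$; $\Delta_\xi$ is the diagonal functor; $\varepsilon_\xi$ is the functor to the trivial category;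 $S_\xi(x)=x^{-1}$ and $S_\xi(x\xrightarrow{e}y)=(x^{-1}\xrightarrow{{}^{x^{-1}}(e^{-1})}y^{-1})$. **Theorem.** The assignment $(\xi,A)\mapsto(\mathcal G_\xi,F_A)$ is a bijective correspondence, up to isomorphism, between pairs $(\xi,A)$, where $\xi$ is a crossed module and $A$ is a Hopf $\xi$-algebra in $\mathcal S$, and Hopf algebras in $\mathcal F(\mathcal S)$. Precisely: 1. it induces a bijection from the isomorphism classes of such pairs to the isomorphism classes of Hopf algebras in $\mathcal F(\mathcal S)$; 2. it extends to an equivalence from the category of such pairs to the category of Hopf algebras in $\mathcal F(\mathcal S)$, sending a morphism of pairs given by $(\psi,\varphi)$ and $\{f_x\}_{x\in H}$ to the morphism given by the functor $x\mapsto\varphi(x)$, $e\mapsto\psi(e)$ and the natural transformation $\{f_x\}_{x\in H}$; 3. for every Hopf algebra with underlying object $(\mathcal C,F)$ in $\mathcal F(\mathcal S)$ there is a pair $(\xi\colon E\to H,A)$ with $H=\mathrm{Ob}(\mathcal C)$ and $A_x=F(x)$ for all $x\in H$, and an isomorphism of Hopf algebras from $(\mathcal G_\xi,F_A)$ to it whose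 functor is the identity on objects and whose natural transformation consists of identities. -/

import Mathlib

open CategoryTheory MonoidalCategory

universe w v u

namespace HopfCrossed

section FCat

/-- The objects of the category `F(S)`: pairs `(C, F)` of a small category `C` and a functor
`F : C ⥤ S`. -/
structure FCat (S : Type u) [Category.{v} S] where
  base : Type w
  [cat : SmallCategory base]
  func : base ⥤ S

attribute [instance] FCat.cat

namespace FCat

variable {S : Type u} [Category.{v} S]

/-- A morphism `(C, F) → (D, G)` of `F(S)`: a pair of a functor `Γ : C ⥤ D` and a natural
transformation `F ⟶ Γ ⋙ G`. -/
structure Hom (X Y : FCat.{w} S) where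
  base : X.base ⥤ Y.base
  fib : X.func ⟶ base ⋙ Y.func

instance : Category (FCat.{w} S) where
  Hom X Y := Hom X Y
  id X := ⟨𝟭 X.base, 𝟙 X.func⟩
  comp f g := ⟨f.base ⋙ g.base, f.fib ≫ Functor.whiskerLeft f.base g.fib⟩
  id_comp f := by
    cases f; congr 1; ext x; simp
  comp_id f := by
    cases f; congr 1; ext x; simp
  assoc f g h := by
    cases f; cases g; cases h; congr 1; ext x; simp

@[simp] theorem id_base (X : FCat.{w} S) : Hom.base (𝟙 X) = 𝟭 X.base := rfl
@[simp] theorem id_fib_app (X : FCat.{w} S) (x : X.base) :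
    (Hom.fib (𝟙 X)).app x = 𝟙 (X.func.obj x) := rfl
@[simp] theorem comp_base {X Y Z : FCat.{w} S} (f : X ⟶ Y) (g : Y ⟶ Z) :
    Hom.base (f ≫ g) = Hom.base f ⋙ Hom.base g := rfl
@[simp] theorem comp_fib_app {X Y Z : FCat.{w} S} (f : X ⟶ Y) (g : Y ⟶ Z) (x : X.base) :
    (Hom.fib (f ≫ g)).app x = (Hom.fib f).app x ≫ (Hom.fib g).app ((Hom.base f).obj x) := rfl

theorem hom_ext {X Y : FCat.{w} S} {f g : X ⟶ Y} (h : Hom.base f = Hom.base g)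
    (h' : ∀ x, (Hom.fib f).app x ≫
      eqToHom (congrArg (fun K : X.base ⥤ Y.base => Y.func.obj (K.obj x)) h)
        = (Hom.fib g).app x) : f = g := by
  obtain ⟨fb, ff⟩ := f
  obtain ⟨gb, gf⟩ := g
  dsimp only at h
  subst h
  congr 1
  ext x
  simpa using h' x

theorem mk_ext {X Y : FCat.{w} S} {b : X.base ⥤ Y.base} {γ γ' : X.func ⟶ b ⋙ Y.func}
    (h : ∀ x, γ.app x = γ'.app x) : (Hom.mk b γ : X ⟶ Y) = Hom.mk b γ' :=
  congrArg (Hom.mk b) (NatTrans.ext (funext h))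

variable [MonoidalCategory S]

/-- The functor `F ⊗ G = ⊗ ∘ (F × G)`. -/
def tensorFunc (X Y : FCat.{w} S) : X.base × Y.base ⥤ S where
  obj p := X.func.obj p.1 ⊗ Y.func.obj p.2
  map f := X.func.map f.1 ⊗ₘ Y.func.map f.2
  map_id p := by simp
  map_comp f g := by simp

/-- `(C, F) ⊠ (D, G) = (C × D, F ⊗ G)`. -/
def tensorObj (X Y : FCat.{w} S) : FCat.{w} S where
  base := X.base × Y.base
  func := tensorFunc X Y

/-- `(Γ, γ) ⊠ (Λ, λ) = (Γ × Λ, {γ_X ⊗ λ_Y})`. -/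
def tensorHom {X X' Y Y' : FCat.{w} S} (f : X ⟶ X') (g : Y ⟶ Y') :
    tensorObj X Y ⟶ tensorObj X' Y' where
  base := (Hom.base f).prod (Hom.base g)
  fib :=
    { app := fun p => (Hom.fib f).app p.1 ⊗ₘ (Hom.fib g).app p.2
      naturality := fun p q h => by
        have h1 := (Hom.fib f).naturality h.1
        have h2 := (Hom.fib g).naturality h.2
        change (X.func.map h.1 ⊗ₘ Y.func.map h.2) ≫
            ((Hom.fib f).app q.1 ⊗ₘ (Hom.fib g).app q.2) =
          ((Hom.fib f).app p.1 ⊗ₘ (Hom.fib g).app p.2) ≫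
            (X'.func.map ((Hom.base f).map h.1) ⊗ₘ Y'.func.map ((Hom.base g).map h.2))
        rw [tensorHom_comp_tensorHom, tensorHom_comp_tensorHom, h1, h2]
        rfl }

/-- The unit object `I = (1, 𝟙_)`. -/
def tensorUnit : FCat.{w} S where
  base := Discrete PUnit.{w + 1}
  func := (Functor.const _).obj (𝟙_ S)

/-- The associator, induced from those of `Cat` and `S`. -/
def associator (X Y Z : FCat.{w} S) :
    tensorObj (tensorObj X Y) Z ≅ tensorObj X (tensorObj Y Z) where
  hom :=
    { base := prod.associator X.base Y.base Z.base
      fib :=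
        { app := fun p => (α_ (X.func.obj p.1.1) (Y.func.obj p.1.2) (Z.func.obj p.2)).hom
          naturality := fun _ _ h =>
            associator_naturality (X.func.map h.1.1) (Y.func.map h.1.2) (Z.func.map h.2) } }
  inv :=
    { base := prod.inverseAssociator X.base Y.base Z.base
      fib :=
        { app := fun p => (α_ (X.func.obj p.1) (Y.func.obj p.2.1) (Z.func.obj p.2.2)).inv
          naturality := fun _ _ h =>
            associator_inv_naturality (X.func.map h.1) (Y.func.map h.2.1) (Z.func.map h.2.2) } }
  hom_inv_id := mk_ext fun _ => Iso.hom_inv_id _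
  inv_hom_id := mk_ext fun _ => Iso.inv_hom_id _

/-- The left unitor, induced from those of `Cat` and `S`. -/
def leftUnitor (X : FCat.{w} S) : tensorObj tensorUnit X ≅ X where
  hom :=
    { base := CategoryTheory.Prod.snd (Discrete PUnit.{w + 1}) X.base
      fib :=
        { app := fun p => (λ_ (X.func.obj p.2)).hom
          naturality := fun _ _ h => by
            change (𝟙 (𝟙_ S) ⊗ₘ X.func.map h.2) ≫ _ = _ ≫ X.func.map h.2
            simp } }
  inv :=
    { base := CategoryTheory.Prod.sectR ⟨⟨⟩⟩ X.base
      fib :=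
        { app := fun x => (λ_ (X.func.obj x)).inv
          naturality := fun _ _ h => by
            change X.func.map h ≫ _ = _ ≫ (𝟙 (𝟙_ S) ⊗ₘ X.func.map h)
            simp } }
  hom_inv_id := mk_ext fun _ => Iso.hom_inv_id _
  inv_hom_id := mk_ext fun _ => Iso.inv_hom_id _

/-- The right unitor, induced from those of `Cat` and `S`. -/
def rightUnitor (X : FCat.{w} S) : tensorObj X tensorUnit ≅ X where
  hom :=
    { base := CategoryTheory.Prod.fst X.base (Discrete PUnit.{w + 1})
      fib :=
        { app := fun p => (ρ_ (X.func.obj p.1)).hom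
          naturality := fun _ _ h => by
            change (X.func.map h.1 ⊗ₘ 𝟙 (𝟙_ S)) ≫ _ = _ ≫ X.func.map h.1
            simp } }
  inv :=
    { base := CategoryTheory.Prod.sectL X.base ⟨⟨⟩⟩
      fib :=
        { app := fun x => (ρ_ (X.func.obj x)).inv
          naturality := fun _ _ h => by
            change X.func.map h ≫ _ = _ ≫ (X.func.map h ⊗ₘ 𝟙 (𝟙_ S))
            simp } }
  hom_inv_id := mk_ext fun _ => Iso.hom_inv_id _
  inv_hom_id := mk_ext fun _ => Iso.inv_hom_id _

instance : MonoidalCategoryStruct (FCat.{w} S) where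
  tensorObj := tensorObj
  tensorHom := tensorHom
  whiskerLeft X _ _ f := tensorHom (𝟙 X) f
  whiskerRight f X := tensorHom f (𝟙 X)
  tensorUnit := tensorUnit
  associator := associator
  leftUnitor := leftUnitor
  rightUnitor := rightUnitor

instance : MonoidalCategory (FCat.{w} S) := MonoidalCategory.ofTensorHom
  (id_tensorHom_id := fun _ _ => mk_ext fun _ => id_tensorHom_id _ _)
  (id_tensorHom := fun _ _ _ _ => rfl)
  (tensorHom_id := fun _ _ => rfl)
  (tensorHom_comp_tensorHom := fun _ _ _ _ => mk_ext fun _ => tensorHom_comp_tensorHom _ _ _ _)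
  (associator_naturality := fun _ _ _ => mk_ext fun _ => associator_naturality _ _ _)
  (leftUnitor_naturality := fun {X Y} f => mk_ext fun x => by
    change (𝟙 (𝟙_ S) ⊗ₘ (Hom.fib f).app x.2) ≫ (λ_ _).hom = (λ_ _).hom ≫ (Hom.fib f).app x.2
    simp)
  (rightUnitor_naturality := fun {X Y} f => mk_ext fun x => by
    change ((Hom.fib f).app x.1 ⊗ₘ 𝟙 (𝟙_ S)) ≫ (ρ_ _).hom = (ρ_ _).hom ≫ (Hom.fib f).app x.1
    simp)
  (pentagon := fun W X Y Z => mk_ext fun x => by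
    change ((α_ (W.func.obj x.1.1.1) (X.func.obj x.1.1.2) (Y.func.obj x.1.2)).hom ⊗ₘ
        𝟙 (Z.func.obj x.2)) ≫ (α_ _ (X.func.obj x.1.1.2 ⊗ Y.func.obj x.1.2) _).hom ≫
          (𝟙 (W.func.obj x.1.1.1) ⊗ₘ (α_ _ _ (Z.func.obj x.2)).hom) =
      (α_ (W.func.obj x.1.1.1 ⊗ X.func.obj x.1.1.2) _ _).hom ≫ (α_ _ _ _).hom
    simp)
  (triangle := fun X Y => mk_ext fun x => by
    change (α_ (X.func.obj x.1.1) (𝟙_ S) (Y.func.obj x.2)).hom ≫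
        (𝟙 (X.func.obj x.1.1) ⊗ₘ (λ_ (Y.func.obj x.2)).hom) =
      ((ρ_ (X.func.obj x.1.1)).hom ⊗ₘ 𝟙 (Y.func.obj x.2))
    simp)

/-- The symmetry, induced from those of `Cat` and `S`. -/
def braiding [BraidedCategory S] (X Y : FCat.{w} S) : X ⊗ Y ≅ Y ⊗ X where
  hom :=
    { base := CategoryTheory.Prod.swap X.base Y.base
      fib :=
        { app := fun p => (β_ (X.func.obj p.1) (Y.func.obj p.2)).hom
          naturality := fun _ _ h =>
            BraidedCategory.braiding_naturality (X.func.map h.1) (Y.func.map h.2) } }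
  inv :=
    { base := CategoryTheory.Prod.swap Y.base X.base
      fib :=
        { app := fun p => (β_ (X.func.obj p.2) (Y.func.obj p.1)).inv
          naturality := fun _ _ h =>
            BraidedCategory.braiding_inv_naturality (Y.func.map h.1) (X.func.map h.2) } }
  hom_inv_id := mk_ext fun _ => Iso.hom_inv_id _
  inv_hom_id := mk_ext fun _ => Iso.inv_hom_id _

instance [BraidedCategory S] : BraidedCategory (FCat.{w} S) where
  braiding := braiding
  braiding_naturality_right X _ _ f := mk_ext fun _ =>
    BraidedCategory.braiding_naturality _ _
  braiding_naturality_left f Z := mk_ext fun _ =>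
    BraidedCategory.braiding_naturality _ _
  hexagon_forward X Y Z := mk_ext fun x => by
    change (α_ (X.func.obj x.1.1) (Y.func.obj x.1.2) (Z.func.obj x.2)).hom ≫
        (β_ (X.func.obj x.1.1) (Y.func.obj x.1.2 ⊗ Z.func.obj x.2)).hom ≫ (α_ _ _ _).hom =
      ((β_ _ _).hom ⊗ₘ 𝟙 _) ≫ (α_ _ _ _).hom ≫ (𝟙 _ ⊗ₘ (β_ _ _).hom)
    simp
  hexagon_reverse X Y Z := mk_ext fun x => by
    change (α_ (X.func.obj x.1) (Y.func.obj x.2.1) (Z.func.obj x.2.2)).inv ≫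
        (β_ (X.func.obj x.1 ⊗ Y.func.obj x.2.1) (Z.func.obj x.2.2)).hom ≫ (α_ _ _ _).inv =
      (𝟙 _ ⊗ₘ (β_ _ _).hom) ≫ (α_ _ _ _).inv ≫ ((β_ _ _).hom ⊗ₘ 𝟙 _)
    simp

instance [SymmetricCategory S] : SymmetricCategory (FCat.{w} S) where
  symmetry _ _ := mk_ext fun _ => SymmetricCategory.symmetry _ _

end FCat
end FCat

section Hopf

open scoped MonObj ComonObj HopfObj

/-- A Hopf algebra in a braided category `B`: a bialgebra which admits an invertible antipode. -/
structure HopfAlg (B : Type u) [Category.{v} B] [MonoidalCategory B] [BraidedCategory B] where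
  X : B
  [hopf : HopfObj X]
  isIso_antipode : IsIso (𝒮[X])

attribute [instance] HopfAlg.hopf HopfAlg.isIso_antipode

namespace HopfAlg

variable {B : Type u} [Category.{v} B] [MonoidalCategory B] [BraidedCategory B]

/-- Morphisms of Hopf algebras are bialgebra morphisms (these commute with the antipodes). -/
@[ext]
structure Hom (M N : HopfAlg B) where
  hom : M.X ⟶ N.X
  isBimonHom : IsBimonHom hom

instance : Category (HopfAlg B) where
  Hom := Hom
  id M := ⟨𝟙 M.X, { }⟩
  comp f g := ⟨f.hom ≫ g.hom,
    haveI := f.isBimonHom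
    haveI := g.isBimonHom
    { }⟩

@[ext]
theorem hom_ext {M N : HopfAlg B} {f g : M ⟶ N} (h : Hom.hom f = Hom.hom g) : f = g :=
  Hom.ext h

end HopfAlg

end Hopf

/-- A crossed module `∂ : E → H`. The action of `x : H` on `e : E` is written `x • e`. -/
structure CrossedModule where
  E : Type w
  H : Type w
  [groupE : Group E]
  [groupH : Group H]
  [action : MulDistribMulAction H E]
  bdry : E →* H
  equivariant : ∀ (x : H) (e : E), bdry (x • e) = x * bdry e * x⁻¹
  peiffer : ∀ e f : E, bdry e • f = e * f * e⁻¹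

attribute [instance] CrossedModule.groupE CrossedModule.groupH CrossedModule.action

namespace CrossedModule

/-- Morphisms of crossed modules. -/
@[ext]
structure Hom (X Y : CrossedModule.{w}) where
  onE : X.E →* Y.E
  onH : X.H →* Y.H
  bdry_onE : ∀ e, Y.bdry (onE e) = onH (X.bdry e)
  smul_onE : ∀ (x : X.H) (e : X.E), onE (x • e) = onH x • onE e

/-- The identity morphism. -/
abbrev Hom.id (X : CrossedModule.{w}) : Hom X X where
  onE := MonoidHom.id _
  onH := MonoidHom.id _
  bdry_onE _ := rfl
  smul_onE _ _ := rfl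

/-- The composition of morphisms. -/
abbrev Hom.comp {X Y Z : CrossedModule.{w}} (f : Hom X Y) (g : Hom Y Z) : Hom X Z where
  onE := g.onE.comp f.onE
  onH := g.onH.comp f.onH
  bdry_onE e := by simp [g.bdry_onE, f.bdry_onE]
  smul_onE x e := by simp [g.smul_onE, f.smul_onE]

theorem bdry_mul_smul (X : CrossedModule.{w}) (x y : X.H) (e f : X.E) :
    X.bdry (e * x • f) * (x * y) = (X.bdry e * x) * (X.bdry f * y) := by
  rw [map_mul, X.equivariant]
  group

theorem bdry_mul_mul (X : CrossedModule.{w}) (x : X.H) (e f : X.E) :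
    X.bdry (f * e) * x = X.bdry f * (X.bdry e * x) := by
  rw [map_mul, mul_assoc]

theorem bdry_smul_inv (X : CrossedModule.{w}) {x y : X.H} {e : X.E} (h : y = X.bdry e * x) :
    y⁻¹ = X.bdry (x⁻¹ • e⁻¹) * x⁻¹ := by
  rw [h, X.equivariant, map_inv]
  group

theorem bdry_one_mul (X : CrossedModule.{w}) (x : X.H) : X.bdry 1 * x = x := by
  rw [map_one, one_mul]

theorem Hom.onH_bdry_mul {X Y : CrossedModule.{w}} (f : Hom X Y) (x : X.H) (e : X.E) :
    Y.bdry (f.onE e) * f.onH x = f.onH (X.bdry e * x) := by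
  rw [f.bdry_onE, map_mul]

/-- The set of objects of the category `G_ξ`: a copy of `H`. -/
@[ext]
structure TwoGroup (X : CrossedModule.{w}) : Type w where
  elem : X.H

/-- The category `G_ξ`: objects are the elements of `H`, morphisms from `x` to `y` are the `e : E`
with `y = ∂(e) x`, and the composition is the product of `E`. -/
instance (X : CrossedModule.{w}) : SmallCategory X.TwoGroup where
  Hom x y := { e : X.E // y.elem = X.bdry e * x.elem }
  id x := ⟨1, (X.bdry_one_mul x.elem).symm⟩
  comp e f := ⟨f.1 * e.1, f.2.trans ((congrArg _ e.2).trans (X.bdry_mul_mul _ _ _).symm)⟩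
  id_comp e := Subtype.ext (mul_one e.1)
  comp_id e := Subtype.ext (one_mul e.1)
  assoc e f g := Subtype.ext (mul_assoc g.1 f.1 e.1).symm

namespace TwoGroup

variable {X : CrossedModule.{w}}

@[ext]
theorem hom_ext {x y : X.TwoGroup} {e f : x ⟶ y} (h : e.1 = f.1) : e = f := Subtype.ext h

@[simp] theorem id_val (x : X.TwoGroup) : (𝟙 x : x ⟶ x).1 = 1 := rfl

@[simp] theorem comp_val {x y z : X.TwoGroup} (e : x ⟶ y) (f : y ⟶ z) : (e ≫ f).1 = f.1 * e.1 := rfl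

@[simp] theorem eqToHom_val {x y : X.TwoGroup} (h : x = y) : (eqToHom h).1 = 1 := by
  subst h; rfl

theorem functor_ext {C : Type u} [Category.{v} C] {F G : C ⥤ X.TwoGroup}
    (h : ∀ c, (F.obj c).elem = (G.obj c).elem)
    (h' : ∀ {c d : C} (f : c ⟶ d), (F.map f).1 = (G.map f).1) : F = G :=
  CategoryTheory.Functor.ext (fun c => TwoGroup.ext (h c)) fun c d f => hom_ext (by simp [h'])

variable (X)

/-- The product functor of `G_ξ`. -/
def mulFunctor : X.TwoGroup × X.TwoGroup ⥤ X.TwoGroup where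
  obj p := ⟨p.1.elem * p.2.elem⟩
  map {p _} f := ⟨f.1.1 * p.1.elem • f.2.1,
    (congrArg₂ (· * ·) f.1.2 f.2.2).trans (X.bdry_mul_smul _ _ _ _).symm⟩
  map_id p := hom_ext (by simp)
  map_comp {p q r} f g := hom_ext (by
    have h₁ := f.1.2
    simp [h₁, mul_smul, X.peiffer, mul_assoc])

/-- The unit functor of `G_ξ`. -/
def oneFunctor : Discrete PUnit.{w + 1} ⥤ X.TwoGroup :=
  (Functor.const _).obj ⟨1⟩

/-- The inversion functor of `G_ξ`. -/
def invFunctor : X.TwoGroup ⥤ X.TwoGroup where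
  obj x := ⟨x.elem⁻¹⟩
  map {x _} e := ⟨x.elem⁻¹ • e.1⁻¹, X.bdry_smul_inv e.2⟩
  map_id x := hom_ext (by simp)
  map_comp {x y z} e f := hom_ext (by
    have h₁ := e.2
    have h₂ := X.peiffer e.1⁻¹ f.1⁻¹
    rw [map_inv] at h₂
    have h₃ : y.elem⁻¹ • f.1⁻¹ = x.elem⁻¹ • (e.1⁻¹ * f.1⁻¹ * e.1⁻¹⁻¹) := by
      rw [← h₂, ← mul_smul, ← mul_inv_rev, ← h₁]
    change x.elem⁻¹ • (f.1 * e.1)⁻¹ = y.elem⁻¹ • f.1⁻¹ * x.elem⁻¹ • e.1⁻¹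
    rw [h₃, mul_inv_rev, ← smul_mul']
    simp)

end TwoGroup

end CrossedModule

theorem eqToHom_family {S : Type u} [Category.{v} S] {I J : Type w} {A : I → S} {B : J → S} {k : I → J}
    (f : ∀ i, A i ⟶ B (k i)) {i j : I} (h : i = j) :
    eqToHom (congrArg A h) ≫ f j = f i ≫ eqToHom (congrArg B (congrArg k h)) := by
  subst h
  simp

section HopfCrossedAlgebra

variable (S : Type u) [Category.{v} S] [MonoidalCategory S] [SymmetricCategory S]

open scoped ComonObj

/-- A Hopf `ξ`-algebra in `S`, for a crossed module `ξ = (∂ : E → H)`. The morphisms `eqToHom _`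
are the identifications `A_x = A_y` for elements `x`, `y` of `H` that are equal by the axioms of
groups and crossed modules. -/
structure HopfCrossedAlgebra (X : CrossedModule.{w}) where
  /-- The underlying family of coalgebras. -/
  A : X.H → S
  [coalg : ∀ x, ComonObj (A x)]
  /-- The product. -/
  mul : ∀ x y, A x ⊗ A y ⟶ A (x * y)
  /-- The unit. -/
  one : 𝟙_ S ⟶ A 1
  /-- The antipode. -/
  antipode : ∀ x, A x ⟶ A x⁻¹
  /-- The `ξ`-action. -/
  act : ∀ x (e : X.E), A x ⟶ A (X.bdry e * x)
  -- The product is a family of coalgebra morphisms.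
  mul_comul : ∀ x y, mul x y ≫ Δ[A (x * y)] =
    (Δ[A x] ⊗ₘ Δ[A y]) ≫ tensorμ (A x) (A x) (A y) (A y) ≫ (mul x y ⊗ₘ mul x y)
  mul_counit : ∀ x y, mul x y ≫ ε[A (x * y)] = (ε[A x] ⊗ₘ ε[A y]) ≫ (λ_ (𝟙_ S)).hom
  -- The unit is a coalgebra morphism.
  one_comul : one ≫ Δ[A 1] = (λ_ (𝟙_ S)).inv ≫ (one ⊗ₘ one)
  one_counit : one ≫ ε[A 1] = 𝟙 (𝟙_ S)
  -- The product is associative and unital.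
  mul_assoc' : ∀ x y z, (mul x y ▷ A z) ≫ mul (x * y) z ≫ eqToHom (congrArg A (mul_assoc x y z)) =
    (α_ (A x) (A y) (A z)).hom ≫ (A x ◁ mul y z) ≫ mul x (y * z)
  one_mul' : ∀ x, (one ▷ A x) ≫ mul 1 x ≫ eqToHom (congrArg A (one_mul x)) = (λ_ (A x)).hom
  mul_one' : ∀ x, (A x ◁ one) ≫ mul x 1 ≫ eqToHom (congrArg A (mul_one x)) = (ρ_ (A x)).hom
  -- The antipode is invertible and satisfies the antipode axiom.
  isIso_antipode : ∀ x, IsIso (antipode x)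
  antipode_left : ∀ x, Δ[A x] ≫ (antipode x ▷ A x) ≫ mul x⁻¹ x ≫
    eqToHom (congrArg A (inv_mul_cancel x)) = ε[A x] ≫ one
  antipode_right : ∀ x, Δ[A x] ≫ (A x ◁ antipode x) ≫ mul x x⁻¹ ≫
    eqToHom (congrArg A (mul_inv_cancel x)) = ε[A x] ≫ one
  -- The action is a family of coalgebra morphisms (they are invertible by the next axioms).
  act_comul : ∀ x e, act x e ≫ Δ[A (X.bdry e * x)] = Δ[A x] ≫ (act x e ⊗ₘ act x e)
  act_counit : ∀ x e, act x e ≫ ε[A (X.bdry e * x)] = ε[A x]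
  -- The axioms of a `ξ`-action.
  act_one : ∀ x, act x 1 ≫ eqToHom (congrArg A (X.bdry_one_mul x)) = 𝟙 (A x)
  act_act : ∀ x e f, act x e ≫ act (X.bdry e * x) f =
    act x (f * e) ≫ eqToHom (congrArg A (X.bdry_mul_mul x e f))
  mul_act : ∀ x y e f, (act x e ⊗ₘ act y f) ≫ mul (X.bdry e * x) (X.bdry f * y) =
    mul x y ≫ act (x * y) (e * x • f) ≫ eqToHom (congrArg A (X.bdry_mul_smul x y e f))

attribute [instance] HopfCrossedAlgebra.coalg HopfCrossedAlgebra.isIso_antipode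

/-- A pair `(ξ, A)` of a crossed module `ξ` and a Hopf `ξ`-algebra `A` in `S`. -/
structure HopfCrossedPair where
  cm : CrossedModule.{w}
  alg : HopfCrossedAlgebra S cm

variable {S}

namespace HopfCrossedPair

/-- A morphism of pairs `(ξ, A) → (ξ', A')`: a morphism of crossed modules `ξ → ξ'` and a family
of coalgebra morphisms `A_x → A'_{φ(x)}` compatible with the products, the units and the actions. -/
structure Hom (P Q : HopfCrossedPair.{w} S) where
  cm : CrossedModule.Hom P.cm Q.cm
  app : ∀ x, P.alg.A x ⟶ Q.alg.A (cm.onH x)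
  app_comul : ∀ x, app x ≫ Δ[Q.alg.A (cm.onH x)] = Δ[P.alg.A x] ≫ (app x ⊗ₘ app x)
  app_counit : ∀ x, app x ≫ ε[Q.alg.A (cm.onH x)] = ε[P.alg.A x]
  mul_app : ∀ x y, P.alg.mul x y ≫ app (x * y) ≫ eqToHom (congrArg Q.alg.A (map_mul cm.onH x y)) =
    (app x ⊗ₘ app y) ≫ Q.alg.mul (cm.onH x) (cm.onH y)
  one_app : P.alg.one ≫ app 1 ≫ eqToHom (congrArg Q.alg.A (map_one cm.onH)) = Q.alg.one
  act_app : ∀ x e, P.alg.act x e ≫ app (P.cm.bdry e * x) =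
    app x ≫ Q.alg.act (cm.onH x) (cm.onE e) ≫ eqToHom (congrArg Q.alg.A (cm.onH_bdry_mul x e))

theorem Hom.ext' {P Q : HopfCrossedPair.{w} S} {f g : Hom P Q} (h : f.cm = g.cm)
    (h' : ∀ x, f.app x ≫ eqToHom (congrArg
      (fun k : CrossedModule.Hom P.cm Q.cm => Q.alg.A (k.onH x)) h) = g.app x) : f = g := by
  obtain ⟨c, a, _, _, _, _, _⟩ := f
  obtain ⟨c', a', _, _, _, _, _⟩ := g
  dsimp only at h
  subst h
  congr 1
  funext x
  simpa using h' x

/-- The identity morphism. -/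
def Hom.id (P : HopfCrossedPair.{w} S) : Hom P P where
  cm := CrossedModule.Hom.id P.cm
  app x := 𝟙 (P.alg.A x)
  app_comul x := by simp [CrossedModule.Hom.id]
  app_counit x := by simp [CrossedModule.Hom.id]
  mul_app x y := by simp [CrossedModule.Hom.id]
  one_app := by simp [CrossedModule.Hom.id]
  act_app x e := by simp [CrossedModule.Hom.id]

/-- The composition of morphisms. -/
def Hom.comp {P Q R : HopfCrossedPair.{w} S} (f : Hom P Q) (g : Hom Q R) : Hom P R where
  cm := f.cm.comp g.cm
  app x := f.app x ≫ g.app (f.cm.onH x)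
  app_comul x := by
    rw [← tensorHom_comp_tensorHom, Category.assoc]
    exact (congrArg (f.app x ≫ ·) (g.app_comul _)).trans
      ((reassoc_of% f.app_comul x) _)
  app_counit x := by
    rw [Category.assoc]
    exact (congrArg (f.app x ≫ ·) (g.app_counit _)).trans (f.app_counit x)
  mul_app x y := by
    rw [← tensorHom_comp_tensorHom, Category.assoc, Category.assoc]
    refine Eq.trans ?_ (congrArg ((f.app x ⊗ₘ f.app y) ≫ ·) (g.mul_app _ _))
    rw [← reassoc_of% f.mul_app x y, reassoc_of% eqToHom_family g.app (map_mul f.cm.onH x y)]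
    simp
  one_app := by
    rw [← g.one_app, ← f.one_app]
    simp only [Category.assoc]
    rw [reassoc_of% eqToHom_family g.app (map_one f.cm.onH)]
    simp
  act_app x e := by
    have h := g.act_app (f.cm.onH x) (f.cm.onE e)
    rw [Category.assoc, ← Category.assoc, f.act_app]
    simp only [Category.assoc]
    rw [eqToHom_family g.app (f.cm.onH_bdry_mul x e), reassoc_of% h]
    simp

instance : Category (HopfCrossedPair.{w} S) where
  Hom := Hom
  id := Hom.id
  comp := Hom.comp
  id_comp f := Hom.ext' rfl fun x => by
    simp [Hom.comp, Hom.id]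
  comp_id f := Hom.ext' rfl fun x => by
    simp [Hom.comp, Hom.id]
  assoc f g h := Hom.ext' rfl fun x => by
    simp [Hom.comp]

end HopfCrossedPair

namespace HopfCrossedAlgebra

variable {X : CrossedModule.{w}} (A : HopfCrossedAlgebra S X)

/-- The product `A_x ⊗ A_y → A_z` for `z = x y`. -/
def mulTo {x y z : X.H} (h : x * y = z) : A.A x ⊗ A.A y ⟶ A.A z :=
  A.mul x y ≫ eqToHom (congrArg A.A h)

/-- The action `A_x → A_y` of `e` for `y = ∂(e) x`. -/
def actTo {x y : X.H} (e : X.E) (h : y = X.bdry e * x) : A.A x ⟶ A.A y :=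
  A.act x e ≫ eqToHom (congrArg A.A h.symm)

theorem mulTo_comul {x y z : X.H} (h : x * y = z) : A.mulTo h ≫ Δ[A.A z] =
    (Δ[A.A x] ⊗ₘ Δ[A.A y]) ≫ tensorμ (A.A x) (A.A x) (A.A y) (A.A y) ≫
      (A.mulTo h ⊗ₘ A.mulTo h) := by
  subst h; simpa [mulTo] using A.mul_comul x y

theorem mulTo_counit {x y z : X.H} (h : x * y = z) : A.mulTo h ≫ ε[A.A z] =
    (ε[A.A x] ⊗ₘ ε[A.A y]) ≫ (λ_ (𝟙_ S)).hom := by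
  subst h; simpa [mulTo] using A.mul_counit x y

theorem mulTo_assoc {x y z u t v : X.H} (h₁ : x * y = u) (h₂ : u * z = t) (h₃ : y * z = v)
    (h₄ : x * v = t) : (A.mulTo h₁ ▷ A.A z) ≫ A.mulTo h₂ =
      (α_ (A.A x) (A.A y) (A.A z)).hom ≫ (A.A x ◁ A.mulTo h₃) ≫ A.mulTo h₄ := by
  subst h₁ h₃ h₄
  simpa [mulTo] using A.mul_assoc' x y z

theorem one_mulTo {x : X.H} (h : 1 * x = x) : (A.one ▷ A.A x) ≫ A.mulTo h = (λ_ (A.A x)).hom :=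
  A.one_mul' x

theorem mulTo_one {x : X.H} (h : x * 1 = x) : (A.A x ◁ A.one) ≫ A.mulTo h = (ρ_ (A.A x)).hom :=
  A.mul_one' x

theorem antipode_mulTo {x : X.H} (h : x⁻¹ * x = 1) :
    Δ[A.A x] ≫ (A.antipode x ▷ A.A x) ≫ A.mulTo h = ε[A.A x] ≫ A.one :=
  A.antipode_left x

theorem mulTo_antipode {x : X.H} (h : x * x⁻¹ = 1) :
    Δ[A.A x] ≫ (A.A x ◁ A.antipode x) ≫ A.mulTo h = ε[A.A x] ≫ A.one :=
  A.antipode_right x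

theorem actTo_comul {x y : X.H} (e : X.E) (h : y = X.bdry e * x) :
    A.actTo e h ≫ Δ[A.A y] = Δ[A.A x] ≫ (A.actTo e h ⊗ₘ A.actTo e h) := by
  subst h; simpa [actTo] using A.act_comul x e

theorem actTo_counit {x y : X.H} (e : X.E) (h : y = X.bdry e * x) :
    A.actTo e h ≫ ε[A.A y] = ε[A.A x] := by
  subst h; simpa [actTo] using A.act_counit x e

theorem actTo_one {x : X.H} (h : x = X.bdry 1 * x) : A.actTo 1 h = 𝟙 (A.A x) :=
  A.act_one x

theorem actTo_comp {x y z : X.H} (e f : X.E) (h : y = X.bdry e * x) (h' : z = X.bdry f * y)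
    (h'' : z = X.bdry (f * e) * x) : A.actTo e h ≫ A.actTo f h' = A.actTo (f * e) h'' := by
  subst h h'
  simp [actTo, A.act_act]

theorem actTo_mulTo {x y z x' y' z' : X.H} (e f : X.E) (h : x * y = z) (h' : x' * y' = z')
    (hx : x' = X.bdry e * x) (hy : y' = X.bdry f * y) (hz : z' = X.bdry (e * x • f) * z) :
    (A.actTo e hx ⊗ₘ A.actTo f hy) ≫ A.mulTo h' = A.mulTo h ≫ A.actTo (e * x • f) hz := by
  subst hx hy h h'
  have := A.mul_act x y e f
  simp [actTo, mulTo, this]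

/-- Uniqueness of inverses for the convolution product. -/
theorem conv_unique {C : S} [ComonObj C] {a b : X.H} (hab : a * b = 1) (hba : b * a = 1)
    (p r : C ⟶ A.A a) (q : C ⟶ A.A b)
    (h : Δ[C] ≫ (p ⊗ₘ q) ≫ A.mulTo hab = ε[C] ≫ A.one)
    (h' : Δ[C] ≫ (q ⊗ₘ r) ≫ A.mulTo hba = ε[C] ≫ A.one) : p = r := by
  have e₁ : Δ[C] ≫ (p ⊗ₘ (Δ[C] ≫ (q ⊗ₘ r) ≫ A.mulTo hba)) ≫ A.mulTo (mul_one a) = p := by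
    rw [h', MonoidalCategory.tensorHom_def, MonoidalCategory.whiskerLeft_comp]
    simp only [Category.assoc]
    rw [A.mulTo_one, ← whisker_exchange_assoc, rightUnitor_naturality,
      ComonObj.comul_counit_assoc]
    simp
  have e₂ : Δ[C] ≫ ((Δ[C] ≫ (p ⊗ₘ q) ≫ A.mulTo hab) ⊗ₘ r) ≫ A.mulTo (one_mul a) = r := by
    rw [h, MonoidalCategory.tensorHom_def', comp_whiskerRight]
    simp only [Category.assoc]
    rw [A.one_mulTo, whisker_exchange_assoc, leftUnitor_naturality,
      ComonObj.counit_comul_assoc]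
    simp
  have e₃ : (p ⊗ₘ (Δ[C] ≫ (q ⊗ₘ r) ≫ A.mulTo hba)) =
      (C ◁ Δ[C]) ≫ (p ⊗ₘ (q ⊗ₘ r)) ≫ (A.A a ◁ A.mulTo hba) := by
    simp only [← id_tensorHom, tensorHom_comp_tensorHom, Category.id_comp, Category.comp_id]
  have e₄ : ((Δ[C] ≫ (p ⊗ₘ q) ≫ A.mulTo hab) ⊗ₘ r) =
      (Δ[C] ▷ C) ≫ ((p ⊗ₘ q) ⊗ₘ r) ≫ (A.mulTo hab ▷ A.A a) := by
    simp only [← tensorHom_id, tensorHom_comp_tensorHom, Category.id_comp, Category.comp_id]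
  rw [e₃] at e₁
  rw [e₄] at e₂
  refine e₁.symm.trans (Eq.trans ?_ e₂)
  simp only [Category.assoc]
  rw [A.mulTo_assoc hab (one_mul a) hba (mul_one a), ComonObj.comul_assoc_assoc,
    MonoidalCategory.associator_naturality_assoc]

/-- The antipode is compatible with the action. -/
theorem act_antipode {x y : X.H} (e : X.E) (h : y = X.bdry e * x)
    (h' : y⁻¹ = X.bdry (x⁻¹ • e⁻¹) * x⁻¹) :
    A.actTo e h ≫ A.antipode y = A.antipode x ≫ A.actTo (x⁻¹ • e⁻¹) h' := by
  symm
  apply A.conv_unique (inv_mul_cancel y) (mul_inv_cancel y) _ _ (A.actTo e h)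
  · have e₁ : ((A.antipode x ≫ A.actTo (x⁻¹ • e⁻¹) h') ⊗ₘ A.actTo e h) =
        (A.antipode x ▷ A.A x) ≫ (A.actTo (x⁻¹ • e⁻¹) h' ⊗ₘ A.actTo e h) := by
      rw [← tensorHom_id, tensorHom_comp_tensorHom, Category.id_comp]
    have h₀ : (x⁻¹ • e⁻¹ : X.E) * x⁻¹ • e = 1 := by simp
    have e₂ := A.actTo_mulTo (x⁻¹ • e⁻¹) e (inv_mul_cancel x) (inv_mul_cancel y) h' h
      (by rw [h₀, map_one, one_mul])
    have e₃ : ∀ (g : X.E) (hg : g = 1) (k : (1 : X.H) = X.bdry g * 1),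
        A.actTo g k = 𝟙 (A.A 1) := by
      rintro _ rfl k
      exact A.actTo_one k
    rw [e₁, Category.assoc, e₂, e₃ _ h₀, Category.comp_id, A.antipode_mulTo]
  · have e₁ : (A.actTo e h ⊗ₘ (A.actTo e h ≫ A.antipode y)) =
        (A.actTo e h ⊗ₘ A.actTo e h) ≫ (A.A y ◁ A.antipode y) := by
      rw [← id_tensorHom, tensorHom_comp_tensorHom, Category.comp_id]
    rw [e₁, Category.assoc, ← reassoc_of% A.actTo_comul e h, A.mulTo_antipode,
      reassoc_of% A.actTo_counit e h]

/-- The object `(G_ξ, F_A)` of `F(S)`, where `F_A(x) = A_x` and `F_A(e : x → ∂(e) x) = φ_{x,e}`. -/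
abbrev toFCat : FCat.{w} S where
  base := X.TwoGroup
  func :=
    { obj := fun x => A.A x.elem
      map := fun e => A.actTo e.1 e.2
      map_id := fun _ => A.actTo_one _
      map_comp := fun _ _ => (A.actTo_comp _ _ _ _ _).symm }

/-- The product `(m_ξ, μ)`. -/
def mulHom : A.toFCat ⊗ A.toFCat ⟶ A.toFCat where
  base := CrossedModule.TwoGroup.mulFunctor X
  fib :=
    { app := fun p => A.mul p.1.elem p.2.elem
      naturality := fun p q f => by
        have h := A.actTo_mulTo f.1.1 f.2.1 rfl rfl f.1.2 f.2.2
          ((CrossedModule.TwoGroup.mulFunctor X).map f).2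
        simp only [mulTo, eqToHom_refl, Category.comp_id] at h
        exact h }

/-- The unit `(u_ξ, η)`. -/
def oneHom : 𝟙_ (FCat.{w} S) ⟶ A.toFCat where
  base := CrossedModule.TwoGroup.oneFunctor X
  fib :=
    { app := fun _ => A.one
      naturality := fun p q f => by
        change 𝟙 (𝟙_ S) ≫ A.one = A.one ≫ A.toFCat.func.map (𝟙 _)
        exact (Category.id_comp _).trans ((Category.comp_id _).symm.trans
          (congrArg (A.one ≫ ·) (A.toFCat.func.map_id (⟨1⟩ : X.TwoGroup)).symm)) }

/-- The coproduct `(Δ_ξ, Δ)`. -/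
def comulHom : A.toFCat ⟶ A.toFCat ⊗ A.toFCat where
  base := Functor.diag X.TwoGroup
  fib :=
    { app := fun x => Δ[A.A x.elem]
      naturality := fun _ _ f => A.actTo_comul f.1 f.2 }

/-- The counit `(ε_ξ, ε)`. -/
def counitHom : A.toFCat ⟶ 𝟙_ (FCat.{w} S) where
  base := (Functor.const X.TwoGroup).obj ⟨⟨⟩⟩
  fib :=
    { app := fun x => ε[A.A x.elem]
      naturality := fun _ _ f => (A.actTo_counit f.1 f.2).trans (Category.comp_id _).symm }

/-- The antipode `(S_ξ, S)`. -/
def antipodeHom : A.toFCat ⟶ A.toFCat where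
  base := CrossedModule.TwoGroup.invFunctor X
  fib :=
    { app := fun x => A.antipode x.elem
      naturality := fun _ _ f => A.act_antipode f.1 f.2 (X.bdry_smul_inv f.2) }

open scoped MonObj HopfObj

theorem one_mul_aux (x : X.H) : ((A.one ⊗ₘ 𝟙 (A.A x)) ≫ A.mul 1 x) ≫
    eqToHom (congrArg A.A (one_mul x)) = (λ_ (A.A x)).hom := by
  rw [Category.assoc, tensorHom_id]
  exact A.one_mul' x

theorem mul_one_aux (x : X.H) : ((𝟙 (A.A x) ⊗ₘ A.one) ≫ A.mul x 1) ≫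
    eqToHom (congrArg A.A (mul_one x)) = (ρ_ (A.A x)).hom := by
  rw [Category.assoc, id_tensorHom]
  exact A.mul_one' x

theorem mul_assoc_aux (x y z : X.H) : ((A.mul x y ⊗ₘ 𝟙 (A.A z)) ≫ A.mul (x * y) z) ≫
    eqToHom (congrArg A.A (mul_assoc x y z)) =
      (α_ (A.A x) (A.A y) (A.A z)).hom ≫ (𝟙 (A.A x) ⊗ₘ A.mul y z) ≫ A.mul x (y * z) := by
  rw [Category.assoc, tensorHom_id, id_tensorHom]
  exact A.mul_assoc' x y z

theorem antipode_left_aux (x : X.H) :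
    (Δ[A.A x] ≫ (A.antipode x ⊗ₘ 𝟙 (A.A x)) ≫ A.mul x⁻¹ x) ≫
      eqToHom (congrArg A.A (inv_mul_cancel x)) = ε[A.A x] ≫ A.one := by
  rw [Category.assoc, Category.assoc, tensorHom_id]
  exact A.antipode_left x

theorem antipode_right_aux (x : X.H) :
    (Δ[A.A x] ≫ (𝟙 (A.A x) ⊗ₘ A.antipode x) ≫ A.mul x x⁻¹) ≫
      eqToHom (congrArg A.A (mul_inv_cancel x)) = ε[A.A x] ≫ A.one := by
  rw [Category.assoc, Category.assoc, id_tensorHom]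
  exact A.antipode_right x

theorem tensorμ_app (W X Y Z : FCat.{w} S) (p : ((W ⊗ X) ⊗ (Y ⊗ Z)).base) :
    (FCat.Hom.fib (tensorμ W X Y Z)).app p =
      tensorμ (W.func.obj p.1.1) (X.func.obj p.1.2) (Y.func.obj p.2.1) (Z.func.obj p.2.2) := by
  change (α_ _ _ _).hom ≫ (𝟙 _ ⊗ₘ (α_ _ _ _).inv) ≫ (𝟙 _ ⊗ₘ ((β_ _ _).hom ⊗ₘ 𝟙 _)) ≫
    (𝟙 _ ⊗ₘ (α_ _ _ _).hom) ≫ (α_ _ _ _).inv = _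
  simp only [tensorμ, id_tensorHom, tensorHom_id]

instance hopfObj : HopfObj A.toFCat where
  mul := A.mulHom
  one := A.oneHom
  comul := A.comulHom
  counit := A.counitHom
  antipode := A.antipodeHom
  one_mul := FCat.hom_ext (CrossedModule.TwoGroup.functor_ext (fun c => one_mul c.2.elem)
    (fun f => show 1 * (1 : X.H) • f.2.1 = f.2.1 by simp)) (fun p => A.one_mul_aux p.2.elem)
  mul_one := FCat.hom_ext (CrossedModule.TwoGroup.functor_ext (fun c => mul_one c.1.elem)
    (fun {c d} f => show f.1.1 * c.1.elem • 1 = f.1.1 by simp)) (fun p => A.mul_one_aux p.1.elem)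
  mul_assoc := FCat.hom_ext (CrossedModule.TwoGroup.functor_ext
    (fun c => mul_assoc c.1.1.elem c.1.2.elem c.2.elem)
    (fun {c d} f => show f.1.1.1 * c.1.1.elem • f.1.2.1 * (c.1.1.elem * c.1.2.elem) • f.2.1 =
      f.1.1.1 * c.1.1.elem • (f.1.2.1 * c.1.2.elem • f.2.1) by simp [mul_smul, mul_assoc]))
    (fun p => A.mul_assoc_aux p.1.1.elem p.1.2.elem p.2.elem)
  counit_comul := FCat.mk_ext fun x => by
    change Δ[A.A x.elem] ≫ (ε[A.A x.elem] ⊗ₘ 𝟙 (A.A x.elem)) = (λ_ (A.A x.elem)).inv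
    simp
  comul_counit := FCat.mk_ext fun x => by
    change Δ[A.A x.elem] ≫ (𝟙 (A.A x.elem) ⊗ₘ ε[A.A x.elem]) = (ρ_ (A.A x.elem)).inv
    simp
  comul_assoc := FCat.mk_ext fun x => by
    change Δ[A.A x.elem] ≫ (𝟙 (A.A x.elem) ⊗ₘ Δ[A.A x.elem]) =
      Δ[A.A x.elem] ≫ (Δ[A.A x.elem] ⊗ₘ 𝟙 (A.A x.elem)) ≫ (α_ _ _ _).hom
    simp
  mul_comul := FCat.mk_ext fun p => by
    refine (A.mul_comul p.1.elem p.2.elem).trans ?_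
    refine congrArg ((Δ[A.A p.1.elem] ⊗ₘ Δ[A.A p.2.elem]) ≫ ·) ?_
    exact congrArg (· ≫ (A.mul p.1.elem p.2.elem ⊗ₘ A.mul p.1.elem p.2.elem))
      (tensorμ_app A.toFCat A.toFCat A.toFCat A.toFCat ((p.1, p.1), (p.2, p.2))).symm
  one_comul := FCat.mk_ext fun _ => A.one_comul
  mul_counit := FCat.mk_ext fun p => A.mul_counit p.1.elem p.2.elem
  one_counit := FCat.mk_ext fun _ => A.one_counit
  antipode_left := FCat.hom_ext (CrossedModule.TwoGroup.functor_ext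
    (fun c => inv_mul_cancel c.elem)
    (fun {c d} f => show c.elem⁻¹ • f.1⁻¹ * c.elem⁻¹ • f.1 = 1 by simp)) (fun x => A.antipode_left_aux x.elem)
  antipode_right := FCat.hom_ext (CrossedModule.TwoGroup.functor_ext
    (fun c => mul_inv_cancel c.elem)
    (fun {c d} f => show f.1 * c.elem • (c.elem⁻¹ • f.1⁻¹) = 1 by simp)) (fun x => A.antipode_right_aux x.elem)

theorem invFunctor_comp_invFunctor (X : CrossedModule.{w}) :
    CrossedModule.TwoGroup.invFunctor X ⋙ CrossedModule.TwoGroup.invFunctor X = 𝟭 X.TwoGroup :=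
  CrossedModule.TwoGroup.functor_ext (fun c => inv_inv c.elem)
    (fun {c _} f => show c.elem⁻¹⁻¹ • (c.elem⁻¹ • f.1⁻¹)⁻¹ = f.1 by
      rw [← smul_inv', inv_inv, inv_inv, smul_inv_smul])

/-- The inverse of `S_x`. -/
noncomputable def antipodeInvAt (x : X.H) : A.A x⁻¹ ⟶ A.A x := inv (A.antipode x)

theorem antipode_antipodeInvAt (x : X.H) : A.antipode x ≫ A.antipodeInvAt x = 𝟙 _ :=
  IsIso.hom_inv_id _

theorem antipodeInvAt_antipode (x : X.H) : A.antipodeInvAt x ≫ A.antipode x = 𝟙 _ :=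
  IsIso.inv_hom_id _

theorem antipodeInvAt_act {a b c d : X.H} (e : X.E) (ha : a⁻¹ = c) (hb : b⁻¹ = d)
    (k : d = X.bdry e * c) (k' : b = X.bdry (c⁻¹ • e⁻¹) * a) :
    A.actTo e k ≫ eqToHom (congrArg A.A hb.symm) ≫ A.antipodeInvAt b =
      (eqToHom (congrArg A.A ha.symm) ≫ A.antipodeInvAt a) ≫ A.actTo (c⁻¹ • e⁻¹) k' := by
  subst ha hb
  have h₀ : a⁻¹ • (a⁻¹⁻¹ • e⁻¹)⁻¹ = e := by
    rw [← smul_inv', inv_inv, inv_inv, inv_smul_smul]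
  have h₁ := A.act_antipode (a⁻¹⁻¹ • e⁻¹) k' (by rw [h₀]; exact k)
  have h₂ : ∀ (g : X.E) (hg : g = e) (l : b⁻¹ = X.bdry g * a⁻¹), A.actTo g l = A.actTo e k := by
    rintro _ rfl l
    rfl
  rw [h₂ _ h₀] at h₁
  have h₃ : A.actTo e k = A.antipodeInvAt a ≫ A.actTo (a⁻¹⁻¹ • e⁻¹) k' ≫ A.antipode b := by
    rw [h₁, ← Category.assoc, A.antipodeInvAt_antipode, Category.id_comp]
  rw [h₃]
  simp [A.antipode_antipodeInvAt]

/-- The inverse of the antipode `(S_ξ, S)`. -/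
noncomputable def antipodeInv : A.toFCat ⟶ A.toFCat where
  base := CrossedModule.TwoGroup.invFunctor X
  fib :=
    { app := fun x => eqToHom (congrArg A.A (inv_inv x.elem).symm) ≫ A.antipodeInvAt x.elem⁻¹
      naturality := fun _ _ f =>
        A.antipodeInvAt_act f.1 (inv_inv _) (inv_inv _) f.2 (X.bdry_smul_inv f.2) }

theorem antipode_antipodeInv_aux {a b : X.H} (h : a = b) :
    (A.antipode b ≫ eqToHom (congrArg (fun z => A.A z⁻¹) h.symm) ≫ A.antipodeInvAt a) ≫
      eqToHom (congrArg A.A h) = 𝟙 (A.A b) := by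
  subst h
  simp [A.antipode_antipodeInvAt]

theorem antipodeInv_antipode_aux {a b : X.H} (h : a⁻¹ = b) :
    ((eqToHom (congrArg A.A h.symm) ≫ A.antipodeInvAt a) ≫ A.antipode a) ≫
      eqToHom (congrArg A.A h) = 𝟙 (A.A b) := by
  subst h
  simp [A.antipodeInvAt_antipode]

theorem isIso_antipodeHom : IsIso A.antipodeHom :=
  ⟨A.antipodeInv,
    FCat.hom_ext (invFunctor_comp_invFunctor X)
      fun x => A.antipode_antipodeInv_aux (inv_inv x.elem),
    FCat.hom_ext (invFunctor_comp_invFunctor X)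
      fun x => A.antipodeInv_antipode_aux (inv_inv x.elem)⟩

end HopfCrossedAlgebra

namespace HopfCrossedPair

/-- The Hopf algebra in `F(S)` associated with a pair `(ξ, A)`. -/
def toHopfAlg (P : HopfCrossedPair.{w} S) : HopfAlg (FCat.{w} S) where
  X := P.alg.toFCat
  hopf := P.alg.hopfObj
  isIso_antipode := P.alg.isIso_antipodeHom

theorem Hom.actTo_app {P Q : HopfCrossedPair.{w} S} (f : P ⟶ Q) {x y : P.cm.H} (e : P.cm.E)
    (h : y = P.cm.bdry e * x) (h' : (Hom.cm f).onH y = Q.cm.bdry ((Hom.cm f).onE e) * (Hom.cm f).onH x) :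
    P.alg.actTo e h ≫ Hom.app f y = Hom.app f x ≫ Q.alg.actTo ((Hom.cm f).onE e) h' := by
  subst h
  simpa [HopfCrossedAlgebra.actTo] using Hom.act_app f x e

/-- The functor `G_ξ → G_ξ'` induced by a morphism of crossed modules. -/
def _root_.HopfCrossed.CrossedModule.Hom.functor {X Y : CrossedModule.{w}}
    (f : CrossedModule.Hom X Y) : X.TwoGroup ⥤ Y.TwoGroup where
  obj x := ⟨f.onH x.elem⟩
  map e := ⟨f.onE e.1, (congrArg f.onH e.2).trans (f.onH_bdry_mul _ _).symm⟩
  map_id _ := CrossedModule.TwoGroup.hom_ext (map_one f.onE)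
  map_comp e e' := CrossedModule.TwoGroup.hom_ext (map_mul f.onE e'.1 e.1)

/-- The morphism `(G_ξ, F_A) → (G_ξ', F_A')` induced by a morphism of pairs. -/
def toFCatHom {P Q : HopfCrossedPair.{w} S} (f : P ⟶ Q) : P.alg.toFCat ⟶ Q.alg.toFCat where
  base := (Hom.cm f).functor
  fib :=
    { app := fun x => Hom.app f x.elem
      naturality := fun _ _ e => Hom.actTo_app f e.1 e.2 ((Hom.cm f).functor.map e).2 }

instance isBimonHom_toFCatHom {P Q : HopfCrossedPair.{w} S} (f : P ⟶ Q) :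
    IsBimonHom (toFCatHom f) where
  one_hom := FCat.hom_ext (CrossedModule.TwoGroup.functor_ext (fun _ => map_one (Hom.cm f).onH)
    (fun _ => map_one (Hom.cm f).onE)) fun _ => by
      exact (Category.assoc _ _ _).trans (Hom.one_app f)
  mul_hom := FCat.hom_ext (CrossedModule.TwoGroup.functor_ext
    (fun p => map_mul (Hom.cm f).onH p.1.elem p.2.elem)
    (fun {p _} e => show (Hom.cm f).onE (e.1.1 * p.1.elem • e.2.1) =
      (Hom.cm f).onE e.1.1 * (Hom.cm f).onH p.1.elem • (Hom.cm f).onE e.2.1 by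
        rw [map_mul, (Hom.cm f).smul_onE])) fun p => by
      exact (Category.assoc _ _ _).trans (Hom.mul_app f p.1.elem p.2.elem)
  hom_counit := FCat.mk_ext fun x => Hom.app_counit f x.elem
  hom_comul := FCat.mk_ext fun x => Hom.app_comul f x.elem

end HopfCrossedPair

/-- The functor sending a pair `(ξ, A)` to the Hopf algebra `(G_ξ, F_A)` in `F(S)`, with product
`(m_ξ, μ)`, unit `(u_ξ, η)`, coproduct `(Δ_ξ, Δ)`, counit `(ε_ξ, ε)` and antipode `(S_ξ, S)`. -/
def pairToHopf (S : Type u) [Category.{v} S] [MonoidalCategory S] [SymmetricCategory S] :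
    HopfCrossedPair.{w} S ⥤ HopfAlg (FCat.{w} S) where
  obj P := P.toHopfAlg
  map f := ⟨HopfCrossedPair.toFCatHom f, HopfCrossedPair.isBimonHom_toFCatHom f⟩
  map_id _ := HopfAlg.hom_ext (FCat.mk_ext fun _ => rfl)
  map_comp _ _ := HopfAlg.hom_ext (FCat.mk_ext fun _ => rfl)

/-- The map induced by `pairToHopf` from isomorphism classes of pairs `(ξ, A)` to isomorphism
classes of Hopf algebras in `F(S)`. -/
def pairToHopfClass (S : Type u) [Category.{v} S] [MonoidalCategory S] [SymmetricCategory S] :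
    Quotient (isIsomorphicSetoid (HopfCrossedPair.{w} S)) →
      Quotient (isIsomorphicSetoid (HopfAlg (FCat.{w} S))) :=
  Quotient.map (pairToHopf S).obj fun _ _ ⟨i⟩ => ⟨(pairToHopf S).mapIso i⟩

end HopfCrossedAlgebra

end HopfCrossed

/-!
The category `F(S)` lies over the cartesian category `Cat`. In a cartesian category every object
has exactly one comonoid structure, the diagonal one, so the coproduct of a Hopf algebra `(C, F)` in
`F(S)` lies over the diagonal functor of `C` (`base_comul`). The natural transformations over
the diagonal and over the constant functor make every `F(x)` a coalgebra and every `F(f)` a coalgebra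
morphism, and the axioms of the product, the unit and the antipode make `C` a strict group object in
`Cat`.

Group objects in `Cat` are crossed modules (Brown and Spencer). To avoid equalities of objects
inside equations between morphisms, all morphisms of `C` are collected in one type `Arr C`. For the
product functor of `C` it is a group, and source, target and identities are homomorphisms.
The interchange law expresses composition through this product: for `f : x ⟶ y` and `g : y ⟶ z`,
the composite `f ≫ g` is both `g * (𝟙 y)⁻¹ * f` and `f * (𝟙 y)⁻¹ * g` (`Arr.mk_comp`,
`Arr.mk_comp'`). Hence the kernels of source and target commute (`Arr.commute_of_src_of_tgt`), which
is the Peiffer identity for the target homomorphism restricted to the kernel `E` of the source, where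
an object acts on `E` by conjugation with its identity (`crossedModule`).

With `H = Ob C` and `A_x = F(x)`, an element `e` of `E` acts on `A_x` by the value of `F` at `e * 𝟙 x`.
The axioms of a Hopf `ξ`-algebra are then the components of the axioms of a Hopf algebra in `F(S)`
(`hopfCrossedAlgebra`). Every `f : x ⟶ y` of `C` is uniquely of the form `e * 𝟙 x`, so `G_ξ` is
isomorphic to `C` over the identity on objects, and this isomorphism, with identities on the values
of `F`, is one of Hopf algebras (`comparison`, `isBimonHom_comparison`). This gives essential
surjectivity together with the precise form of the realization.

For full faithfulness, a multiplicative functor `G_ξ ⥤ G_ξ'` is determined by its values on objects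
and on morphisms with source `1`, because `f : x ⟶ y` is the product of such a morphism and `𝟙 x`;
these values form a morphism of crossed modules (`CrossedModule.homOfFunctor`).
-/

namespace HopfCrossed

open scoped MonObj ComonObj HopfObj

/-! ### Equalities and isomorphisms in `F(S)` -/

namespace FCat

variable {S : Type u} [Category.{v} S]

theorem fib_app_eq {X Y : FCat.{w} S} {f g : X ⟶ Y} (h : f = g) (x : X.base) :
    (Hom.fib f).app x ≫
      eqToHom (congrArg (fun k : X ⟶ Y => Y.func.obj ((Hom.base k).obj x)) h) =
        (Hom.fib g).app x := by
  subst h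
  simp

/-- If two morphisms with the same underlying functor are equal, so are their natural
transformations. -/
theorem mk_app_eq {X Y : FCat.{w} S} {b : X.base ⥤ Y.base} {t s : X.func ⟶ b ⋙ Y.func}
    (h : (Hom.mk b t : X ⟶ Y) = Hom.mk b s) (x : X.base) : t.app x = s.app x := by
  simpa using fib_app_eq h x

theorem exists_eq_mk {X Y : FCat.{w} S} (f : X ⟶ Y) {b : X.base ⥤ Y.base}
    (h : Hom.base f = b) : ∃ t : X.func ⟶ b ⋙ Y.func, f = Hom.mk b t := by
  subst h
  exact ⟨Hom.fib f, rfl⟩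

theorem obj_eq {X Y : FCat.{w} S} {f g : X ⟶ Y} (h : f = g) (x : X.base) :
    (Hom.base f).obj x = (Hom.base g).obj x := by
  subst h
  rfl

theorem map_comp_eqToHom (X : FCat.{w} S) {x y z : X.base} (f : x ⟶ y) (h : y = z) :
    X.func.map f ≫ eqToHom (congrArg X.func.obj h) = X.func.map (f ≫ eqToHom h) := by
  subst h
  simp

/-- The components of an isomorphism of `F(S)` are isomorphisms. -/
theorem isIso_fib_app {X Y : FCat.{w} S} (f : X ⟶ Y) [IsIso f] (x : X.base) :
    IsIso ((Hom.fib f).app x) := by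
  have h₁ := fib_app_eq (IsIso.hom_inv_id f) x
  have h₂ := fib_app_eq (IsIso.inv_hom_id f) ((Hom.base f).obj x)
  rw [comp_fib_app, id_fib_app, Category.assoc] at h₁ h₂
  -- The component of `inv f` at the image of `x` has inverses on both sides.
  have : IsSplitMono ((Hom.fib (inv f)).app ((Hom.base f).obj x)) := ⟨⟨⟨_, h₂⟩⟩⟩
  have hx : (Hom.base (inv f)).obj ((Hom.base f).obj x) = x := obj_eq (IsIso.hom_inv_id f) x
  have h₃ : (Hom.fib f).app x ≫ (Hom.fib (inv f)).app ((Hom.base f).obj x) =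
      eqToHom (congrArg X.func.obj hx).symm :=
    (cancel_mono (eqToHom (congrArg X.func.obj hx))).1
      ((Category.assoc _ _ _).trans (h₁.trans (by simp)))
  have : IsSplitEpi ((Hom.fib (inv f)).app ((Hom.base f).obj x)) :=
    ⟨⟨⟨eqToHom (congrArg X.func.obj hx) ≫ (Hom.fib f).app x, by
      rw [Category.assoc, h₃]; simp⟩⟩⟩
  have : IsIso ((Hom.fib (inv f)).app ((Hom.base f).obj x)) := isIso_of_epi_of_isSplitMono _
  have h₄ : IsIso ((Hom.fib f).app x ≫ (Hom.fib (inv f)).app ((Hom.base f).obj x)) := by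
    rw [h₃]; infer_instance
  exact IsIso.of_isIso_comp_right _ ((Hom.fib (inv f)).app ((Hom.base f).obj x))

end FCat

/-! ### The coalgebras underlying a comonoid in `F(S)` -/

section Comonoid

variable {S : Type u} [Category.{v} S] [MonoidalCategory S] (X : FCat.{w} S)

/-- `Cat` is cartesian, so a coproduct admitting a counit lies over the diagonal functor. -/
theorem base_comul [ComonObj X] : FCat.Hom.base Δ[X] = Functor.diag X.base := by
  have h₁ := congrArg (fun f => FCat.Hom.base f ⋙ CategoryTheory.Prod.snd _ _)
    (ComonObj.counit_comul X)
  have h₂ := congrArg (fun f => FCat.Hom.base f ⋙ CategoryTheory.Prod.fst _ _)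
    (ComonObj.comul_counit X)
  change FCat.Hom.base Δ[X] ⋙ CategoryTheory.Prod.snd X.base X.base = 𝟭 X.base at h₁
  change FCat.Hom.base Δ[X] ⋙ CategoryTheory.Prod.fst X.base X.base = 𝟭 X.base at h₂
  change (FCat.Hom.base Δ[X] ⋙ CategoryTheory.Prod.fst X.base X.base).prod'
    (FCat.Hom.base Δ[X] ⋙ CategoryTheory.Prod.snd X.base X.base) = _
  rw [h₁, h₂]
  rfl

theorem base_to_unit (f : X ⟶ 𝟙_ (FCat.{w} S)) :
    FCat.Hom.base f = (Functor.const X.base).obj ⟨⟨⟩⟩ :=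
  CategoryTheory.Functor.ext (fun _ => rfl) fun _ _ _ =>
    Subsingleton.elim (α := (⟨⟨⟩⟩ : Discrete PUnit.{w + 1}) ⟶ ⟨⟨⟩⟩) _ _

theorem exists_comul_eq [ComonObj X] :
    ∃ t : X.func ⟶ Functor.diag X.base ⋙ (X ⊗ X).func, Δ[X] = FCat.Hom.mk _ t :=
  FCat.exists_eq_mk _ (base_comul X)

theorem exists_counit_eq [ComonObj X] :
    ∃ t : X.func ⟶ (Functor.const X.base).obj ⟨⟨⟩⟩ ⋙ (𝟙_ (FCat.{w} S)).func,
      ε[X] = FCat.Hom.mk _ t :=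
  FCat.exists_eq_mk _ (base_to_unit X _)

/-- The coproduct of a comonoid in `F(S)`, as a natural transformation over the diagonal functor. -/
noncomputable def fibComul [ComonObj X] : X.func ⟶ Functor.diag X.base ⋙ (X ⊗ X).func :=
  (exists_comul_eq X).choose

/-- The counit of a comonoid in `F(S)`, as a natural transformation over the constant functor. -/
noncomputable def fibCounit [ComonObj X] :
    X.func ⟶ (Functor.const X.base).obj ⟨⟨⟩⟩ ⋙ (𝟙_ (FCat.{w} S)).func :=
  (exists_counit_eq X).choose

theorem comul_eq [ComonObj X] : Δ[X] = FCat.Hom.mk _ (fibComul X) := (exists_comul_eq X).choose_spec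

theorem counit_eq [ComonObj X] : ε[X] = FCat.Hom.mk _ (fibCounit X) :=
  (exists_counit_eq X).choose_spec

/-- The coalgebra `F(x)` for a comonoid `(C, F)` in `F(S)` and an object `x` of `C`. -/
noncomputable instance comonObjFiber [ComonObj X] (x : X.base) : ComonObj (X.func.obj x) where
  counit := (fibCounit X).app x
  comul := (fibComul X).app x
  counit_comul := by
    have h := ComonObj.counit_comul X
    rw [comul_eq, counit_eq] at h
    exact (congrArg ((fibComul X).app x ≫ ·) (tensorHom_id _ _)).symm.trans (FCat.mk_app_eq h x)
  comul_counit := by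
    have h := ComonObj.comul_counit X
    rw [comul_eq, counit_eq] at h
    exact (congrArg ((fibComul X).app x ≫ ·) (id_tensorHom _ _)).symm.trans (FCat.mk_app_eq h x)
  comul_assoc := by
    have h := ComonObj.comul_assoc X
    rw [comul_eq] at h
    have h' := FCat.mk_app_eq h x
    change (fibComul X).app x ≫ (𝟙 _ ⊗ₘ (fibComul X).app x) =
      (fibComul X).app x ≫ ((fibComul X).app x ⊗ₘ 𝟙 _) ≫ (α_ _ _ _).hom at h'
    rwa [id_tensorHom, tensorHom_id] at h'

theorem map_comul [ComonObj X] {x y : X.base} (f : x ⟶ y) :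
    X.func.map f ≫ Δ[X.func.obj y] = Δ[X.func.obj x] ≫ (X.func.map f ⊗ₘ X.func.map f) :=
  (fibComul X).naturality f

theorem map_counit [ComonObj X] {x y : X.base} (f : x ⟶ y) :
    X.func.map f ≫ ε[X.func.obj y] = ε[X.func.obj x] :=
  ((fibCounit X).naturality f).trans (Category.comp_id _)

end Comonoid

/-! ### The group of arrows of a Hopf algebra in `F(S)` -/

section Arrows

variable {S : Type u} [Category.{v} S] [MonoidalCategory S] [SymmetricCategory S]
  (X : FCat.{w} S) [HopfObj X]

instance baseMul : Mul X.base where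
  mul a b := (FCat.Hom.base μ[X]).obj (a, b)

instance baseOne : One X.base where
  one := (FCat.Hom.base η[X]).obj ⟨⟨⟩⟩

instance baseInv : Inv X.base where
  inv := (FCat.Hom.base 𝒮[X]).obj

/-- The objects of the category underlying a Hopf algebra in `F(S)` form a group: the antipode
lies over the inversion because the coproduct lies over the diagonal. -/
instance baseGroup : Group X.base :=
  Group.ofLeftAxioms
    (fun a b c => FCat.obj_eq (MonObj.mul_assoc X) ((a, b), c))
    (fun a => FCat.obj_eq (MonObj.one_mul X) (⟨⟨⟩⟩, a))
    (fun a => by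
      have h := HopfObj.antipode_left X
      rw [comul_eq] at h
      exact FCat.obj_eq h a)

variable {X} in
/-- The product of two morphisms of the category underlying a Hopf algebra in `F(S)`. -/
def mulMap {x y x' y' : X.base} (f : x ⟶ y) (f' : x' ⟶ y') : x * x' ⟶ y * y' :=
  (FCat.Hom.base μ[X]).map (X := (x, x')) (Y := (y, y')) (f, f')

variable {X} in
theorem mulMap_id (x x' : X.base) : mulMap (𝟙 x) (𝟙 x') = 𝟙 (x * x') :=
  (FCat.Hom.base μ[X]).map_id (x, x')

variable {X} in
/-- The interchange law between the composition of morphisms and their product. -/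
theorem mulMap_comp {x y z x' y' z' : X.base} (f : x ⟶ y) (g : y ⟶ z) (f' : x' ⟶ y')
    (g' : y' ⟶ z') : mulMap (f ≫ g) (f' ≫ g') = mulMap f f' ≫ mulMap g g' :=
  (FCat.Hom.base μ[X]).map_comp (X := (x, x')) (Y := (y, y')) (Z := (z, z')) (f, f') (g, g')

/-- The arrows of a category, without fixed source and target. Equality of arrows replaces equality
of morphisms up to `eqToHom`. -/
structure Arr (C : Type w) [SmallCategory C] where
  src : C
  tgt : C
  hom : src ⟶ tgt

namespace Arr

variable {C : Type w} [SmallCategory C]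

theorem mk_injective {x y : C} {f g : x ⟶ y} (h : Arr.mk x y f = Arr.mk x y g) : f = g := by
  cases h
  rfl

theorem mk_comp_eqToHom {x y z : C} (f : x ⟶ y) (h : y = z) :
    Arr.mk x z (f ≫ eqToHom h) = Arr.mk x y f := by
  subst h
  simp

theorem mk_eqToHom_comp {x y z : C} (f : y ⟶ z) (h : x = y) :
    Arr.mk x z (eqToHom h ≫ f) = Arr.mk y z f := by
  subst h
  simp

theorem mk_comp_congr {x y z x' y' z' : C} {f : x ⟶ y} {g : y ⟶ z} {f' : x' ⟶ y'} {g' : y' ⟶ z'}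
    (h : Arr.mk x y f = Arr.mk x' y' f') (h' : Arr.mk y z g = Arr.mk y' z' g') :
    Arr.mk x z (f ≫ g) = Arr.mk x' z' (f' ≫ g') := by
  cases h
  cases h'
  rfl

theorem mk_map_eq {D : Type*} [Category D] {F G : D ⥤ C} (h : F = G) {x y : D} (f : x ⟶ y) :
    Arr.mk _ _ (F.map f) = Arr.mk _ _ (G.map f) := by
  subst h
  rfl

theorem functor_ext {D : Type*} [Category D] {F G : D ⥤ C} (h : ∀ x, F.obj x = G.obj x)
    (h' : ∀ {x y : D} (f : x ⟶ y), Arr.mk _ _ (F.map f) = Arr.mk _ _ (G.map f)) : F = G :=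
  CategoryTheory.Functor.ext h fun _ _ f => mk_injective <| by
    rw [mk_eqToHom_comp, mk_comp_eqToHom, h']

/-- An arrow, as a morphism between given objects equal to its source and target. -/
def homOf (a : Arr C) {x y : C} (hx : a.src = x) (hy : a.tgt = y) : x ⟶ y :=
  eqToHom hx.symm ≫ a.hom ≫ eqToHom hy

@[simp]
theorem mk_homOf (a : Arr C) {x y : C} (hx : a.src = x) (hy : a.tgt = y) :
    Arr.mk x y (a.homOf hx hy) = a := by
  subst hx hy
  simp [homOf]

instance : Mul (Arr X.base) where
  mul a b := ⟨a.src * b.src, a.tgt * b.tgt, mulMap a.hom b.hom⟩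

instance : One (Arr X.base) where
  one := ⟨1, 1, 𝟙 1⟩

instance : Inv (Arr X.base) where
  inv a := ⟨a.src⁻¹, a.tgt⁻¹, (FCat.Hom.base 𝒮[X]).map a.hom⟩

/-- The product functor, the unit functor and the inversion functor of the category underlying a
Hopf algebra in `F(S)` turn its arrows into a group. -/
instance : Group (Arr X.base) :=
  Group.ofLeftAxioms
    (fun a b c => mk_map_eq (congrArg FCat.Hom.base (MonObj.mul_assoc X))
      (x := ((a.src, b.src), c.src)) (y := ((a.tgt, b.tgt), c.tgt)) ((a.hom, b.hom), c.hom))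
    (fun a => (congrArg (fun e => Arr.mk (1 * a.src) (1 * a.tgt) (mulMap e a.hom))
      ((FCat.Hom.base η[X]).map_id ⟨⟨⟩⟩)).symm.trans
        (mk_map_eq (congrArg FCat.Hom.base (MonObj.one_mul X)) (x := (⟨⟨⟩⟩, a.src))
          (y := (⟨⟨⟩⟩, a.tgt)) (𝟙 _, a.hom)))
    (fun a => by
      have h := HopfObj.antipode_left X
      rw [comul_eq, counit_eq] at h
      exact (mk_map_eq (congrArg FCat.Hom.base h) a.hom).trans
        (congrArg (Arr.mk _ _) ((FCat.Hom.base η[X]).map_id ⟨⟨⟩⟩)))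

variable {X}

theorem mk_mul_mk {x y x' y' : X.base} (f : x ⟶ y) (f' : x' ⟶ y') :
    Arr.mk x y f * Arr.mk x' y' f' = Arr.mk (x * x') (y * y') (mulMap f f') := rfl

variable (X) in
/-- The source homomorphism. -/
@[simps] def srcHom : Arr X.base →* X.base where
  toFun := src
  map_one' := rfl
  map_mul' _ _ := rfl

variable (X) in
/-- The target homomorphism. -/
@[simps] def tgtHom : Arr X.base →* X.base where
  toFun := tgt
  map_one' := rfl
  map_mul' _ _ := rfl

variable (X) in
/-- The homomorphism sending an object to its identity. -/
def idHom : X.base →* Arr X.base where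
  toFun x := ⟨x, x, 𝟙 x⟩
  map_one' := rfl
  map_mul' x y := (congrArg (Arr.mk (x * y) (x * y)) (mulMap_id x y)).symm

theorem mk_id (x : X.base) : Arr.mk x x (𝟙 x) = idHom X x := rfl

@[simp] theorem src_idHom (x : X.base) : (idHom X x).src = x := rfl
@[simp] theorem tgt_idHom (x : X.base) : (idHom X x).tgt = x := rfl

@[simp] theorem src_mul (a b : Arr X.base) : (a * b).src = a.src * b.src := rfl
@[simp] theorem tgt_mul (a b : Arr X.base) : (a * b).tgt = a.tgt * b.tgt := rfl
@[simp] theorem src_inv (a : Arr X.base) : (a⁻¹).src = a.src⁻¹ := rfl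
@[simp] theorem tgt_inv (a : Arr X.base) : (a⁻¹).tgt = a.tgt⁻¹ := rfl

/-- The composition of arrows is determined by their product. -/
theorem mk_comp {x y z : X.base} (f : x ⟶ y) (g : y ⟶ z) :
    Arr.mk x z (f ≫ g) = Arr.mk y z g * (idHom X y)⁻¹ * Arr.mk x y f := by
  -- Interchange for `(𝟙 y ≫ g) * (𝟙 y⁻¹ ≫ 𝟙 y⁻¹) * (f ≫ 𝟙 y)`.
  have h := (mulMap_comp (mulMap (𝟙 y) (𝟙 y⁻¹)) (mulMap g (𝟙 y⁻¹)) f (𝟙 y))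
  rw [← mulMap_comp, Category.id_comp, Category.comp_id, Category.comp_id] at h
  rw [← map_inv, ← mk_id y⁻¹, mk_mul_mk, mk_mul_mk, h]
  refine mk_comp_congr ?_ ?_
  · rw [← mk_mul_mk, ← mk_mul_mk, mk_id, mk_id, ← map_mul]
    simp
  · rw [← mk_mul_mk, ← mk_mul_mk, mk_id, mk_id, mul_assoc, ← map_mul]
    simp

/-- The interchange law also expresses the composition by the product in the opposite order. -/
theorem mk_comp' {x y z : X.base} (f : x ⟶ y) (g : y ⟶ z) :
    Arr.mk x z (f ≫ g) = Arr.mk x y f * (idHom X y)⁻¹ * Arr.mk y z g := by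
  -- Interchange for `(f ≫ 𝟙 y) * (𝟙 y⁻¹ ≫ 𝟙 y⁻¹) * (𝟙 y ≫ g)`.
  have h := (mulMap_comp (mulMap f (𝟙 y⁻¹)) (mulMap (𝟙 y) (𝟙 y⁻¹)) (𝟙 y) g)
  rw [← mulMap_comp, Category.id_comp, Category.comp_id, Category.id_comp] at h
  rw [← map_inv, ← mk_id y⁻¹, mk_mul_mk, mk_mul_mk, h]
  refine mk_comp_congr ?_ ?_
  · rw [← mk_mul_mk, ← mk_mul_mk, mk_id, mk_id, mul_assoc, ← map_mul]
    simp
  · rw [← mk_mul_mk, ← mk_mul_mk, mk_id, mk_id, ← map_mul]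
    simp

/-- Both composition formulas applied to `k : x ⟶ 1` and `f : 1 ⟶ y` show that the kernels of the
source and of the target commute. -/
theorem commute_of_src_of_tgt (f k : Arr X.base) (hf : f.src = 1) (hk : k.tgt = 1) :
    f * k = k * f := by
  obtain ⟨x, y, f⟩ := f
  obtain ⟨z, t, k⟩ := k
  dsimp only at hf hk
  subst hf hk
  have h := (mk_comp k f).symm.trans (mk_comp' k f)
  simpa using h

end Arr

end Arrows

/-! ### The crossed module and the Hopf `ξ`-algebra of a Hopf algebra in `F(S)` -/

section Reconstruction

variable {S : Type u} [Category.{v} S] [MonoidalCategory S] [SymmetricCategory S]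
  (X : FCat.{w} S) [HopfObj X]

/-- The group of objects acts on the kernel of the source homomorphism, through conjugation by the
identities. -/
instance conjAction : MulDistribMulAction X.base (Arr.srcHom X).ker where
  smul x e := ⟨Arr.idHom X x * e.1 * (Arr.idHom X x)⁻¹, by
    have h : e.1.src = 1 := e.2
    simp [MonoidHom.mem_ker, h]⟩
  one_smul e := Subtype.ext (show Arr.idHom X 1 * e.1 * (Arr.idHom X 1)⁻¹ = e.1 by simp)
  mul_smul x y e := Subtype.ext (show Arr.idHom X (x * y) * e.1 * (Arr.idHom X (x * y))⁻¹ =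
      Arr.idHom X x * (Arr.idHom X y * e.1 * (Arr.idHom X y)⁻¹) * (Arr.idHom X x)⁻¹ by
    rw [map_mul]; group)
  smul_mul x e f := Subtype.ext (show Arr.idHom X x * (e.1 * f.1) * (Arr.idHom X x)⁻¹ =
      (Arr.idHom X x * e.1 * (Arr.idHom X x)⁻¹) * (Arr.idHom X x * f.1 * (Arr.idHom X x)⁻¹) by
    group)
  smul_one x := Subtype.ext (show Arr.idHom X x * 1 * (Arr.idHom X x)⁻¹ = 1 by simp)

theorem coe_conj_smul (x : X.base) (e : (Arr.srcHom X).ker) :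
    ((x • e : (Arr.srcHom X).ker) : Arr X.base) =
      Arr.idHom X x * e.1 * (Arr.idHom X x)⁻¹ := rfl

/-- The crossed module of a Hopf algebra `(C, F)` in `F(S)`: the target homomorphism, from the
group of arrows with source `1` to the group of objects of `C`. -/
abbrev crossedModule : CrossedModule.{w} where
  E := (Arr.srcHom X).ker
  H := X.base
  bdry := (Arr.tgtHom X).comp (Arr.srcHom X).ker.subtype
  equivariant x e := by simp [coe_conj_smul]
  peiffer e f := Subtype.ext <| by
    have he : e.1.src = 1 := e.2
    -- `(𝟙 (t e))⁻¹ * e` has target `1`, so it commutes with `f`, which has source `1`.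
    have h := Arr.commute_of_src_of_tgt f.1 ((Arr.idHom X e.1.tgt)⁻¹ * e.1) f.2 (by simp)
    change Arr.idHom X e.1.tgt * f.1 * (Arr.idHom X e.1.tgt)⁻¹ = e.1 * f.1 * e.1⁻¹
    rw [mul_inv_eq_iff_eq_mul, ← mul_right_inj (Arr.idHom X e.1.tgt)⁻¹,
      ← mul_left_inj ((Arr.idHom X e.1.tgt)⁻¹ * e.1)]
    rw [inv_mul_cancel_left, h]
    group

variable {X}

/-- The morphism `x ⟶ y` of `C` given by an element `e` of the crossed module such that
`y = ∂(e) x`, namely the product of `e` and the identity of `x`. -/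
def actMap {x y : X.base} (e : (Arr.srcHom X).ker) (h : y = (crossedModule X).bdry e * x) :
    x ⟶ y :=
  (e.1 * Arr.idHom X x).homOf
    ((congrArg (· * x) (show e.1.src = 1 from e.2)).trans (one_mul x)) h.symm

@[simp]
theorem mk_actMap {x y : X.base} (e : (Arr.srcHom X).ker)
    (h : y = (crossedModule X).bdry e * x) :
    Arr.mk x y (actMap e h) = e.1 * Arr.idHom X x :=
  Arr.mk_homOf _ _ _

theorem actMap_comp_eqToHom {x y z : X.base} (e : (Arr.srcHom X).ker)
    (h : y = (crossedModule X).bdry e * x) (h' : y = z) :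
    actMap e h ≫ eqToHom h' = actMap e (h'.symm.trans h) := by
  subst h'
  simp

theorem actMap_one {x : X.base} (h : x = (crossedModule X).bdry 1 * x) :
    actMap 1 h = 𝟙 x :=
  Arr.mk_injective (by simp [Arr.mk_id])

theorem actMap_comp {x y z : X.base} (e f : (Arr.srcHom X).ker)
    (h : y = (crossedModule X).bdry e * x) (h' : z = (crossedModule X).bdry f * y)
    (h'' : z = (crossedModule X).bdry (f * e) * x) :
    actMap e h ≫ actMap f h' = actMap (f * e) h'' :=
  Arr.mk_injective (by simp [Arr.mk_comp, mul_assoc])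

theorem mulMap_actMap {x y x' y' : X.base} (e f : (Arr.srcHom X).ker)
    (h : x' = (crossedModule X).bdry e * x) (h' : y' = (crossedModule X).bdry f * y)
    (h'' : x' * y' = (crossedModule X).bdry (e * x • f) * (x * y)) :
    mulMap (actMap e h) (actMap f h') = actMap (e * x • f) h'' :=
  Arr.mk_injective (by simp [← Arr.mk_mul_mk, coe_conj_smul, mul_assoc])

variable (X) in
/-- The product of a Hopf algebra `(C, F)` in `F(S)`, on the values of `F`. -/
def fibMul (x y : X.base) : X.func.obj x ⊗ X.func.obj y ⟶ X.func.obj (x * y) :=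
  (FCat.Hom.fib μ[X]).app (x, y)

variable (X) in
/-- The unit of a Hopf algebra `(C, F)` in `F(S)`, on the values of `F`. -/
def fibOne : 𝟙_ S ⟶ X.func.obj 1 :=
  (FCat.Hom.fib η[X]).app ⟨⟨⟩⟩

variable (X) in
/-- The antipode of a Hopf algebra `(C, F)` in `F(S)`, on the values of `F`. -/
def fibAntipode (x : X.base) : X.func.obj x ⟶ X.func.obj x⁻¹ :=
  (FCat.Hom.fib 𝒮[X]).app x

theorem fibMul_naturality {x y x' y' : X.base} (f : x ⟶ y) (f' : x' ⟶ y') :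
    (X.func.map f ⊗ₘ X.func.map f') ≫ fibMul X y y' =
      fibMul X x x' ≫ X.func.map (mulMap f f') :=
  (FCat.Hom.fib μ[X]).naturality (X := (x, x')) (Y := (y, y')) (f, f')

variable (X) [IsIso 𝒮[X]]

/-- The Hopf `ξ`-algebra of a Hopf algebra `(C, F)` in `F(S)`: the coalgebras `F(x)`, with the
structure given by the natural transformations of the Hopf algebra, and the action given by the
values of `F` on morphisms. -/
noncomputable abbrev hopfCrossedAlgebra : HopfCrossedAlgebra S (crossedModule X) where
  A := X.func.obj
  mul := fibMul X
  one := fibOne X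
  antipode := fibAntipode X
  act x e := X.func.map (actMap e rfl)
  mul_comul x y := by
    have h := BimonObj.mul_comul X
    rw [comul_eq] at h
    refine (FCat.mk_app_eq h (x, y)).trans ?_
    refine congrArg ((Δ[X.func.obj x] ⊗ₘ Δ[X.func.obj y]) ≫ ·) ?_
    exact congrArg (· ≫ (fibMul X x y ⊗ₘ fibMul X x y))
      (HopfCrossedAlgebra.tensorμ_app X X X X ((x, x), (y, y)))
  mul_counit x y := by
    have h : μ[X] ≫ ε[X] = (ε[X] ⊗ₘ ε[X]) ≫ (λ_ (𝟙_ (FCat.{w} S))).hom := BimonObj.mul_counit X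
    rw [counit_eq] at h
    exact FCat.mk_app_eq h (x, y)
  one_comul := by
    have h := BimonObj.one_comul X
    rw [comul_eq] at h
    exact FCat.mk_app_eq h ⟨⟨⟩⟩
  one_counit := by
    have h := BimonObj.one_counit X
    rw [counit_eq] at h
    exact FCat.mk_app_eq h ⟨⟨⟩⟩
  mul_assoc' x y z := by
    rw [← tensorHom_id, ← id_tensorHom, ← Category.assoc]
    exact FCat.fib_app_eq (MonObj.mul_assoc X) ((x, y), z)
  one_mul' x := by
    rw [← tensorHom_id, ← Category.assoc]
    exact FCat.fib_app_eq (MonObj.one_mul X) (⟨⟨⟩⟩, x)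
  mul_one' x := by
    rw [← id_tensorHom, ← Category.assoc]
    exact FCat.fib_app_eq (MonObj.mul_one X) (x, ⟨⟨⟩⟩)
  isIso_antipode x := FCat.isIso_fib_app 𝒮[X] x
  antipode_left x := by
    have h := HopfObj.antipode_left X
    rw [comul_eq, counit_eq] at h
    rw [← tensorHom_id, ← Category.assoc, ← Category.assoc, Category.assoc Δ[X.func.obj x]]
    exact FCat.fib_app_eq h x
  antipode_right x := by
    have h := HopfObj.antipode_right X
    rw [comul_eq, counit_eq] at h
    rw [← id_tensorHom, ← Category.assoc, ← Category.assoc, Category.assoc Δ[X.func.obj x]]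
    exact FCat.fib_app_eq h x
  act_comul x e := map_comul X _
  act_counit x e := map_counit X _
  act_one x := by
    rw [FCat.map_comp_eqToHom X _ ((crossedModule X).bdry_one_mul x), actMap_comp_eqToHom,
      actMap_one, X.func.map_id]
  act_act x e f := by
    rw [FCat.map_comp_eqToHom X _ ((crossedModule X).bdry_mul_mul x e f), actMap_comp_eqToHom,
      ← X.func.map_comp, actMap_comp]
  mul_act x y e f := by
    rw [FCat.map_comp_eqToHom X _ ((crossedModule X).bdry_mul_smul x y e f),
      actMap_comp_eqToHom, fibMul_naturality, mulMap_actMap]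

end Reconstruction

/-! ### The comparison isomorphism -/

section Comparison

variable {S : Type u} [Category.{v} S] [MonoidalCategory S] [SymmetricCategory S]

namespace HopfAlg

variable {B : Type u} [Category.{v} B] [MonoidalCategory B] [BraidedCategory B]

/-- A morphism of Hopf algebras whose underlying morphism is invertible is an isomorphism. -/
def isoOfIso {M N : HopfAlg B} (f : M ⟶ N) (i : M.X ≅ N.X) (h : i.hom = Hom.hom f) :
    M ≅ N where
  hom := f
  inv := ⟨i.inv,
    haveI : IsBimonHom i.hom := h ▸ f.isBimonHom
    { }⟩
  hom_inv_id := hom_ext (by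
    change Hom.hom f ≫ i.inv = 𝟙 _
    rw [← h, i.hom_inv_id])
  inv_hom_id := hom_ext (by
    change i.inv ≫ Hom.hom f = 𝟙 _
    rw [← h, i.inv_hom_id])

end HopfAlg

theorem functor_from_unit_ext {C : Type*} [Category C] {F G : Discrete PUnit.{w + 1} ⥤ C}
    (h : F.obj ⟨⟨⟩⟩ = G.obj ⟨⟨⟩⟩) : F = G :=
  CategoryTheory.Functor.ext (fun _ => h) (by
    rintro ⟨⟨⟩⟩ ⟨⟨⟩⟩ ⟨⟨⟨⟩⟩⟩
    exact (F.map_id _).trans (by simp))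

variable (X : FCat.{w} S) [HopfObj X]

/-- The functor `G_ξ ⥤ C` that is the identity on objects and sends `e : x ⟶ ∂(e) x` to the product
of `e` and the identity of `x`. -/
def fromTwoGroup : (crossedModule X).TwoGroup ⥤ X.base where
  obj x := x.elem
  map e := actMap e.1 e.2
  map_id _ := actMap_one _
  map_comp _ _ := (actMap_comp _ _ _ _ _).symm

/-- The functor `C ⥤ G_ξ` that is the identity on objects and divides a morphism by the identity
of its source. -/
def toTwoGroup : X.base ⥤ (crossedModule X).TwoGroup where
  obj x := ⟨x⟩
  map {x y} f := ⟨⟨Arr.mk x y f * (Arr.idHom X x)⁻¹, by simp [MonoidHom.mem_ker]⟩,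
    show y = y * x⁻¹ * x by simp⟩
  map_id x := CrossedModule.TwoGroup.hom_ext (Subtype.ext (by
    change Arr.mk x x (𝟙 x) * (Arr.idHom X x)⁻¹ = 1
    simp [Arr.mk_id]))
  map_comp {x y z} f g := CrossedModule.TwoGroup.hom_ext (Subtype.ext (by
    change Arr.mk x z (f ≫ g) * (Arr.idHom X x)⁻¹ =
      Arr.mk y z g * (Arr.idHom X y)⁻¹ * (Arr.mk x y f * (Arr.idHom X x)⁻¹)
    simp [Arr.mk_comp, mul_assoc]))

theorem fromTwoGroup_comp_toTwoGroup : fromTwoGroup X ⋙ toTwoGroup X = 𝟭 _ :=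
  CrossedModule.TwoGroup.functor_ext (fun _ => rfl) fun {x y} e => Subtype.ext (by
    change Arr.mk x.elem y.elem (actMap e.1 e.2) * (Arr.idHom X x.elem)⁻¹ = e.1.1
    simp)

theorem toTwoGroup_comp_fromTwoGroup : toTwoGroup X ⋙ fromTwoGroup X = 𝟭 _ :=
  Arr.functor_ext (fun _ => rfl) fun {x y} f => by
    refine (mk_actMap ((toTwoGroup X).map f).1 ((toTwoGroup X).map f).2).trans ?_
    change Arr.mk x y f * (Arr.idHom X x)⁻¹ * Arr.idHom X x = Arr.mk x y f
    simp

variable [IsIso 𝒮[X]]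

/-- The functor `F_A` is the restriction of `F` along `G_ξ ⥤ C`. -/
theorem toFCat_map {x y : (crossedModule X).TwoGroup} (e : x ⟶ y) :
    (hopfCrossedAlgebra X).toFCat.func.map e = X.func.map ((fromTwoGroup X).map e) := by
  refine (FCat.map_comp_eqToHom X (actMap e.1 rfl) e.2.symm).trans ?_
  rw [actMap_comp_eqToHom]
  rfl

/-- The isomorphism `(G_ξ, F_A) ≅ (C, F)` that is the identity on objects and consists of
identities. -/
noncomputable def comparison : (hopfCrossedAlgebra X).toFCat ≅ X where
  hom :=
    { base := fromTwoGroup X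
      fib :=
        { app := fun x => 𝟙 (X.func.obj x.elem)
          naturality := fun _ _ e => (Category.comp_id _).trans
            ((toFCat_map X e).trans (Category.id_comp _).symm) } }
  inv :=
    { base := toTwoGroup X
      fib :=
        { app := fun x => 𝟙 (X.func.obj x)
          naturality := fun x y f => by
            refine (Category.comp_id _).trans (Eq.trans ?_ (Category.id_comp _).symm)
            refine Eq.trans ?_ (toFCat_map X ((toTwoGroup X).map f)).symm
            refine congrArg X.func.map (Arr.mk_injective ?_)
            exact (Arr.mk_map_eq (toTwoGroup_comp_fromTwoGroup X) f).symm } }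
  hom_inv_id := FCat.hom_ext (fromTwoGroup_comp_toTwoGroup X) fun x => by
    exact (congrArg (· ≫ _) (Category.comp_id (𝟙 (X.func.obj x.elem)))).trans (Category.id_comp _)
  inv_hom_id := FCat.hom_ext (toTwoGroup_comp_fromTwoGroup X) fun x => by
    exact (congrArg (· ≫ _) (Category.comp_id (𝟙 (X.func.obj x)))).trans (Category.id_comp _)

/-- The structure of `(G_ξ, F_A)` is built from the components of the structure of `(C, F)`, so only
the compatibility of the product functors on morphisms is not immediate. -/
theorem isBimonHom_comparison : IsBimonHom (comparison X).hom where
  one_hom := FCat.hom_ext (functor_from_unit_ext rfl) fun x =>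
    (congrArg (· ≫ _) (Category.comp_id (fibOne X))).trans (Category.comp_id _)
  mul_hom := FCat.hom_ext (Arr.functor_ext (fun _ => rfl) fun {x y} e =>
      congrArg (Arr.mk (x.1.elem * x.2.elem) (y.1.elem * y.2.elem))
        (mulMap_actMap e.1.1 e.2.1 e.1.2 e.2.2
          ((CrossedModule.TwoGroup.mulFunctor _).map e).2).symm) fun p => by
    change (fibMul X p.1.elem p.2.elem ≫ 𝟙 (X.func.obj _)) ≫ 𝟙 (X.func.obj _) =
      (𝟙 (X.func.obj p.1.elem) ⊗ₘ 𝟙 (X.func.obj p.2.elem)) ≫ fibMul X p.1.elem p.2.elem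
    simp
  hom_counit := by
    rw [counit_eq]
    exact FCat.mk_ext fun x => Category.id_comp _
  hom_comul := by
    rw [comul_eq]
    refine FCat.mk_ext fun x => ?_
    change 𝟙 (X.func.obj x.elem) ≫ Δ[X.func.obj x.elem] =
      Δ[X.func.obj x.elem] ≫ (𝟙 (X.func.obj x.elem) ⊗ₘ 𝟙 (X.func.obj x.elem))
    simp

/-- The pair `(ξ, A)` of a Hopf algebra in `F(S)`. -/
noncomputable abbrev hopfToPair (B : HopfAlg (FCat.{w} S)) : HopfCrossedPair.{w} S :=
  ⟨crossedModule B.X, hopfCrossedAlgebra B.X⟩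

/-- Every Hopf algebra in `F(S)` is isomorphic to the one of its pair. -/
noncomputable def hopfComparison (B : HopfAlg (FCat.{w} S)) :
    (pairToHopf S).obj (hopfToPair B) ≅ B :=
  HopfAlg.isoOfIso ⟨(comparison B.X).hom, isBimonHom_comparison B.X⟩ (comparison B.X) rfl

end Comparison

/-! ### Full faithfulness -/

section FullyFaithful

variable {S : Type u} [Category.{v} S] [MonoidalCategory S] [SymmetricCategory S]

namespace CrossedModule

variable {X Y : CrossedModule.{w}}

/-- An element `e` of `E`, as a morphism `1 ⟶ ∂(e)` of `G_ξ`. -/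
def fromOne (e : X.E) : (⟨1⟩ : X.TwoGroup) ⟶ ⟨X.bdry e⟩ := ⟨e, (mul_one _).symm⟩

/-- The target of a morphism of `G_ξ` is determined by its source and its underlying element, so a
functor takes equal values on morphisms that agree on these. -/
theorem map_val_congr (Γ : X.TwoGroup ⥤ Y.TwoGroup) {x y x' y' : X.TwoGroup} {f : x ⟶ y}
    {f' : x' ⟶ y'} (hx : x = x') (h : f.1 = f'.1) : (Γ.map f).1 = (Γ.map f').1 := by
  subst hx
  obtain rfl : y = y' := TwoGroup.ext (f.2.trans ((congrArg (X.bdry · * _) h).trans f'.2.symm))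
  rw [TwoGroup.hom_ext h]

section Multiplicative

variable (Γ : X.TwoGroup ⥤ Y.TwoGroup)

/-- The homomorphism on objects of a multiplicative functor `G_ξ ⥤ G_ξ'`. -/
def objHom (hm : TwoGroup.mulFunctor X ⋙ Γ = Γ.prod Γ ⋙ TwoGroup.mulFunctor Y) :
    X.H →* Y.H :=
  MonoidHom.mk' (fun x => (Γ.obj ⟨x⟩).elem) fun x y =>
    congrArg (fun F : X.TwoGroup × X.TwoGroup ⥤ Y.TwoGroup => (F.obj (⟨x⟩, ⟨y⟩)).elem) hm

theorem map_val_mul (hm : TwoGroup.mulFunctor X ⋙ Γ = Γ.prod Γ ⋙ TwoGroup.mulFunctor Y)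
    {x y x' y' : X.TwoGroup} (f : x ⟶ y) (f' : x' ⟶ y') :
    (Γ.map ((TwoGroup.mulFunctor X).map (X := (x, x')) (Y := (y, y')) (f, f'))).1 =
      (Γ.map f).1 * (Γ.obj x).elem • (Γ.map f').1 := by
  have h : ∀ {F G : X.TwoGroup × X.TwoGroup ⥤ Y.TwoGroup}, F = G →
      (F.map (X := (x, x')) (Y := (y, y')) (f, f')).1 =
        (G.map (X := (x, x')) (Y := (y, y')) (f, f')).1 := by
    rintro F _ rfl
    rfl
  exact h hm

/-- A multiplicative functor is determined on morphisms by its values on those with source `1`,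
since `f : x ⟶ y` is the product of a morphism with source `1` and the identity of `x`. -/
theorem map_val_fromOne
    (hm : TwoGroup.mulFunctor X ⋙ Γ = Γ.prod Γ ⋙ TwoGroup.mulFunctor Y) {x y : X.TwoGroup}
    (f : x ⟶ y) : (Γ.map f).1 = (Γ.map (fromOne f.1)).1 := by
  refine (map_val_congr Γ (TwoGroup.ext (one_mul x.elem).symm) ?_).trans
    ((map_val_mul Γ hm (fromOne f.1) (𝟙 x)).trans ?_)
  · exact (show f.1 = f.1 * (1 : X.H) • (1 : X.E) by simp)
  · simp

/-- The morphism of crossed modules of a multiplicative functor `G_ξ ⥤ G_ξ'`. -/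
def homOfFunctor (hm : TwoGroup.mulFunctor X ⋙ Γ = Γ.prod Γ ⋙ TwoGroup.mulFunctor Y) :
    Hom X Y where
  onH := objHom Γ hm
  onE := MonoidHom.mk' (fun e => (Γ.map (fromOne e)).1) fun e f => by
    have h := map_val_mul Γ hm (fromOne e) (fromOne f)
    rw [map_val_fromOne Γ hm] at h
    have h₁ : (Γ.obj ⟨1⟩).elem = 1 := (objHom Γ hm).map_one
    refine Eq.trans ?_ (h.trans (congrArg (_ * ·)
      ((congrArg (· • (Γ.map (fromOne f)).1) h₁).trans (one_smul _ _))))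
    exact congrArg (fun k => (Γ.map (fromOne k)).1)
      (show e * f = e * (1 : X.H) • f by rw [one_smul])
  bdry_onE e := by
    have h := (Γ.map (fromOne e)).2
    have h₁ : (Γ.obj ⟨1⟩).elem = 1 := (objHom Γ hm).map_one
    exact (h.trans ((congrArg (_ * ·) h₁).trans (mul_one _))).symm
  smul_onE x e := by
    have h := map_val_mul Γ hm (𝟙 (⟨x⟩ : X.TwoGroup)) (fromOne e)
    rw [map_val_fromOne Γ hm, Γ.map_id, TwoGroup.id_val, one_mul] at h
    refine Eq.trans ?_ h
    exact congrArg (fun k => (Γ.map (fromOne k)).1)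
      (show x • e = 1 * x • e by rw [one_mul])

theorem homOfFunctor_functor
    (hm : TwoGroup.mulFunctor X ⋙ Γ = Γ.prod Γ ⋙ TwoGroup.mulFunctor Y) :
    (homOfFunctor Γ hm).functor = Γ :=
  TwoGroup.functor_ext (fun _ => rfl) fun f => (map_val_fromOne Γ hm f).symm

end Multiplicative

theorem Hom.functor_injective {f g : Hom X Y} (h : f.functor = g.functor) : f = g := by
  have h' : ∀ {F G : X.TwoGroup ⥤ Y.TwoGroup}, F = G → ∀ {x y : X.TwoGroup} (e : x ⟶ y),
      (F.map e).1 = (G.map e).1 := by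
    rintro F _ rfl
    exact fun _ => rfl
  refine Hom.ext (MonoidHom.ext fun e => h' h (fromOne e)) (MonoidHom.ext fun x => ?_)
  exact congrArg (fun F : X.TwoGroup ⥤ Y.TwoGroup => (F.obj ⟨x⟩).elem) h

end CrossedModule

theorem HopfCrossedAlgebra.actTo_congr {X : CrossedModule.{w}} (A : HopfCrossedAlgebra S X)
    {x y : X.H} {e f : X.E} (h : e = f) (he : y = X.bdry e * x) (hf : y = X.bdry f * x) :
    A.actTo e he = A.actTo f hf := by
  subst h
  rfl

instance pairToHopf_faithful : (pairToHopf.{w} S).Faithful where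
  map_injective {P Q f g} h := by
    have h' : HopfCrossedPair.toFCatHom f = HopfCrossedPair.toFCatHom g :=
      congrArg HopfAlg.Hom.hom h
    have hc : HopfCrossedPair.Hom.cm f = HopfCrossedPair.Hom.cm g :=
      CrossedModule.Hom.functor_injective (congrArg FCat.Hom.base h')
    exact HopfCrossedPair.Hom.ext' hc fun x => FCat.fib_app_eq h' ⟨x⟩

theorem base_multiplicative {P Q : HopfCrossedPair.{w} S}
    (b : (pairToHopf.{w} S).obj P ⟶ (pairToHopf.{w} S).obj Q) :
    CrossedModule.TwoGroup.mulFunctor P.cm ⋙ FCat.Hom.base (HopfAlg.Hom.hom b) =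
      (FCat.Hom.base (HopfAlg.Hom.hom b)).prod (FCat.Hom.base (HopfAlg.Hom.hom b)) ⋙
        CrossedModule.TwoGroup.mulFunctor Q.cm :=
  congrArg FCat.Hom.base b.isBimonHom.mul_hom

/-- The morphism of pairs of a morphism of Hopf algebras. -/
def homOfHopfHom {P Q : HopfCrossedPair.{w} S}
    (b : (pairToHopf.{w} S).obj P ⟶ (pairToHopf.{w} S).obj Q) : P ⟶ Q where
  cm := CrossedModule.homOfFunctor (FCat.Hom.base (HopfAlg.Hom.hom b)) (base_multiplicative b)
  app x := (FCat.Hom.fib (HopfAlg.Hom.hom b)).app ⟨x⟩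
  app_comul x := FCat.mk_app_eq b.isBimonHom.hom_comul ⟨x⟩
  app_counit x := FCat.mk_app_eq b.isBimonHom.hom_counit ⟨x⟩
  mul_app x y := by
    exact (Category.assoc _ _ _).symm.trans (FCat.fib_app_eq b.isBimonHom.mul_hom (⟨x⟩, ⟨y⟩))
  one_app :=
    (Category.assoc _ _ _).symm.trans (FCat.fib_app_eq b.isBimonHom.one_hom ⟨⟨⟩⟩)
  act_app x e := by
    let f : (⟨x⟩ : P.cm.TwoGroup) ⟶ ⟨P.cm.bdry e * x⟩ := ⟨e, rfl⟩
    have h := (FCat.Hom.fib (HopfAlg.Hom.hom b)).naturality f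
    refine ((congrArg (· ≫ _) (Category.comp_id (P.alg.act x e))).symm.trans h).trans ?_
    refine congrArg (_ ≫ ·) ?_
    exact Q.alg.actTo_congr
      (CrossedModule.map_val_fromOne _ (base_multiplicative b) f)
        ((FCat.Hom.base (HopfAlg.Hom.hom b)).map f).2
        (CrossedModule.Hom.onH_bdry_mul
          (CrossedModule.homOfFunctor _ (base_multiplicative b)) x e).symm

instance pairToHopf_full : (pairToHopf.{w} S).Full where
  map_surjective b := ⟨homOfHopfHom b, HopfAlg.hom_ext (FCat.hom_ext
    (CrossedModule.homOfFunctor_functor _ (base_multiplicative b)) fun _ => Category.comp_id _)⟩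

instance pairToHopf_essSurj : (pairToHopf.{w} S).EssSurj where
  mem_essImage B := ⟨hopfToPair B, ⟨hopfComparison B⟩⟩

instance pairToHopf_isEquivalence : (pairToHopf.{w} S).IsEquivalence where

variable (S) in
theorem pairToHopfClass_bijective : Function.Bijective (pairToHopfClass.{w} S) := by
  constructor
  · rintro ⟨P⟩ ⟨Q⟩ h
    obtain ⟨i⟩ := Quotient.exact h
    exact Quotient.sound ⟨(pairToHopf S).preimageIso i⟩
  · rintro ⟨B⟩
    exact ⟨⟦hopfToPair B⟧, Quotient.sound ⟨hopfComparison B⟩⟩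

end FullyFaithful

end HopfCrossed

theorem mainTheorem8 (S : Type u) [Category.{v} S] [MonoidalCategory S] [SymmetricCategory S] :
    -- `(ξ, A) ↦ (G_ξ, F_A)` induces a bijection on isomorphism classes,
    Function.Bijective (HopfCrossed.pairToHopfClass.{w} S) ∧
    -- and, more precisely, it is an equivalence of categories,
    (HopfCrossed.pairToHopf.{w} S).IsEquivalence ∧
    -- where every Hopf algebra `(C, F)` in `F(S)` is realized by a pair with `H = Ob C` and
    -- `A_x = F x`, through an isomorphism that is the identity on these data.
    ∀ B : HopfCrossed.HopfAlg (HopfCrossed.FCat.{w} S),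
      ∃ (P : HopfCrossed.HopfCrossedPair.{w} S) (i : (HopfCrossed.pairToHopf.{w} S).obj P ≅ B)
        (h : P.cm.H = B.X.base), ∀ x : P.cm.H,
          (HopfCrossed.FCat.Hom.base (HopfCrossed.HopfAlg.Hom.hom i.hom)).obj
            (⟨x⟩ : P.cm.TwoGroup) = cast h x ∧
          ∃ h' : P.alg.A x = B.X.func.obj
              ((HopfCrossed.FCat.Hom.base (HopfCrossed.HopfAlg.Hom.hom i.hom)).obj
                (⟨x⟩ : P.cm.TwoGroup)),
            (HopfCrossed.FCat.Hom.fib (HopfCrossed.HopfAlg.Hom.hom i.hom)).app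
              (⟨x⟩ : P.cm.TwoGroup) = eqToHom h' := by
  refine ⟨HopfCrossed.pairToHopfClass_bijective S, inferInstance, fun B =>
    ⟨HopfCrossed.hopfToPair B, HopfCrossed.hopfComparison B, rfl, fun x => ⟨rfl, rfl, rfl⟩⟩⟩
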